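/- **Conventions.** A Lie groupoid $\mathcal G$ consists of smooth manifolds $\mathcal G_0$ of objects (Hausdorff, second countable) and $\mathcal G_1$ of arrows (not necessarily Hausdorff), each of some fixed finite dimension and without boundary, and smooth maps $\mathbf s,\mathbf t\colon\mathcal G_1\to\mathcal G_0$ (source and target, both submersions), $u\colon \mathcal G_0\to\mathcal G_1$ (units), $g\mapsto g^{-1}$ (inversion) and a multiplication $(g,h)\mapsto gh$, smooth on $\{(g,h):\mathbf s(g)=\mathbf t(h)\}$, satisfying the groupoid axioms. A homomorphism $F\colon\mathcal H\to\mathcal G$ is a pair of smooth maps $F_0\colon\mathcal H_0\to\mathcal G_0$, $F_1\colon\mathcal H_1\to\mathcal G_1$ compatible with source, target and multiplication. It is a *weak equivalence* if 1. the map $\{(g,x)\in\mathcal G_1\times\mathcal H_0:\mathbf s(g)=F_0(x)\}\to\mathcal G_0$, $(g,x)\mapsto\mathbf t(g)$, is a surjective submersion, and 2. the map $\mathcal H_1\to\{(x,g,y)\in\mathcal H_0\times\mathcal G_1\times\mathcal H_0: F_0(x)=\mathbf t(g),\ \mathbf s(g)=F_0(y)\}$, $h\mapsto(\mathbf t(h),F_1(h),\mathbf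 s(h))$, is a diffeomorphism. Two Lie groupoids are *Morita equivalent* if they are joined by a finite zig-zag of weak equivalences between Lie groupoids. For $n\ge1$ let $\mathcal G^{(n)}\subset\mathcal G_1^{\,n}$ be the manifold of strings $(g_n,\dots,g_1)$ with $\mathbf s(g_{i+1})=\mathbf t(g_i)$, and let $\mathcal G^{(0)}=\mathcal G_0$. The face maps $d^n_i\colon\mathcal G^{(n)}\to\mathcal G^{(n-1)}$, $0\le i\le n$, are $d^1_0=\mathbf t$, $d^1_1=\mathbf s$ and, for $n\ge2$, $d^n_0$ drops $g_1$, $d^n_n$ drops $g_n$, and $d^n_i$ replaces the pair $g_{i+1},g_i$ by $g_{i+1}g_i$ for $0<i<n$. The groupoid cochain complex $C(\mathcal G)$ is the complex of real vector spaces $C^\infty(\mathcal G^{(n)})$, $n\ge0$, with differential $$\delta^n=\sum_{i=0}^{n+1}(-1)^i(d^{n+1}_i)^*\colon C^\infty(\mathcal G^{(n)})\to C^\infty(\mathcal G^{(n+1)}),$$ and $H^n(C(\mathcal G))$ is its cohomology (the differentiable cohomology of $\mathcal G$). **Corollary.** If $\mathcal G$ and $\mathcal H$ are Morita equivalent Lie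 groupoids, then $H(C(\mathcal G))\cong H(C(\mathcal H))$: for every $n\ge0$ there is an isomorphism of real vector spaces $H^n(C(\mathcal G))\cong H^n(C(\mathcal H))$. -/

import Mathlib

open Set Function CategoryTheory
open scoped Manifold ContDiff

universe u

/-! ### Smooth maps on subsets of manifolds -/

section SmoothOnSubset

variable {E : Type*} [NormedAddCommGroup E] [NormedSpace ℝ E] {H : Type*} [TopologicalSpace H]
  {E' : Type*} [NormedAddCommGroup E'] [NormedSpace ℝ E'] {H' : Type*} [TopologicalSpace H']
  {E'' : Type*} [NormedAddCommGroup E''] [NormedSpace ℝ E''] {H'' : Type*} [TopologicalSpace H'']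
  {M : Type*} [TopologicalSpace M] [ChartedSpace H M]
  {N : Type*} [TopologicalSpace N] [ChartedSpace H' N]
  {P : Type*} [TopologicalSpace P] [ChartedSpace H'' P]

/-- A map `f : S → N` from a subset `S` of a manifold `M` to a manifold `N` is smooth if, near every
point of `S`, it is the restriction of a smooth map defined on an open subset of `M`. If `S` is an
embedded submanifold (such as a transverse fibre product inside a product), these are exactly the
smooth maps for the submanifold structure of `S`. -/
def SmoothOnSubset (I : ModelWithCorners ℝ E H) (J : ModelWithCorners ℝ E' H')
    (S : Set M) (f : S → N) : Prop :=
  ∀ x : S, ∃ U : Set M, IsOpen U ∧ (x : M) ∈ U ∧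
    ∃ f' : M → N, ContMDiffOn I J ∞ f' U ∧ ∀ y : S, (y : M) ∈ U → f' y = f y

variable {I : ModelWithCorners ℝ E H} {J : ModelWithCorners ℝ E' H'}
  {K : ModelWithCorners ℝ E'' H''} {S : Set M}

theorem SmoothOnSubset.of_contMDiff {f' : M → N} (hf : ContMDiff I J ∞ f') :
    SmoothOnSubset I J S (fun x => f' x) :=
  fun _ => ⟨univ, isOpen_univ, mem_univ _, f', hf.contMDiffOn, fun _ _ => rfl⟩

theorem SmoothOnSubset.comp {T : Set N} {h : T → P} {g : S → T}
    (hh : SmoothOnSubset J K T h) (hg : SmoothOnSubset I J S (fun x => (g x : N))) :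
    SmoothOnSubset I K S (fun x => h (g x)) := by
  intro x
  obtain ⟨U, hU, hxU, g', hg', hgU⟩ := hg x
  obtain ⟨V, hV, hxV, h', hh', hhV⟩ := hh (g x)
  refine ⟨U ∩ g' ⁻¹' V, hg'.continuousOn.isOpen_inter_preimage hU hV, ⟨hxU, ?_⟩, h' ∘ g', ?_, ?_⟩
  · rw [mem_preimage, hgU x hxU]
    exact hxV
  · exact hh'.comp (hg'.mono inter_subset_left) inter_subset_right
  · rintro y ⟨hyU, hyV⟩
    have e := hgU y hyU
    rw [mem_preimage, e] at hyV
    rw [comp_apply, e]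
    exact hhV _ hyV

theorem SmoothOnSubset.contMDiff_comp {h : N → P} {g : S → N}
    (hh : ContMDiff J K ∞ h) (hg : SmoothOnSubset I J S g) :
    SmoothOnSubset I K S (fun x => h (g x)) := by
  intro x
  obtain ⟨U, hU, hxU, g', hg', hgU⟩ := hg x
  exact ⟨U, hU, hxU, h ∘ g', hh.comp_contMDiffOn hg',
    fun y hy => by rw [comp_apply, hgU y hy]⟩

theorem SmoothOnSubset.prodMk {f : S → N} {g : S → P}
    (hf : SmoothOnSubset I J S f) (hg : SmoothOnSubset I K S g) :
    SmoothOnSubset I (J.prod K) S (fun x => (f x, g x)) := by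
  intro x
  obtain ⟨U, hU, hxU, f', hf', hfU⟩ := hf x
  obtain ⟨V, hV, hxV, g', hg', hgV⟩ := hg x
  refine ⟨U ∩ V, hU.inter hV, ⟨hxU, hxV⟩, fun y => (f' y, g' y),
    (hf'.mono inter_subset_left).prodMk (hg'.mono inter_subset_right), ?_⟩
  rintro y ⟨hyU, hyV⟩
  exact Prod.ext (hfU y hyU) (hgV y hyV)

section Pi

variable {ι : Type*} [Fintype ι]

theorem contMDiffOn_pi_manifold {f : M → ι → N} {U : Set M}
    (hf : ∀ i, ContMDiffOn I J ∞ (fun x => f x i) U) :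
    ContMDiffOn I (ModelWithCorners.pi fun _ : ι => J) ∞ f U := by
  intro x hx
  have h := fun i => contMDiffWithinAt_iff.1 (hf i x hx)
  exact contMDiffWithinAt_iff.2
    ⟨continuousWithinAt_pi.2 fun i => (h i).1, contDiffWithinAt_pi.2 fun i => (h i).2⟩

theorem contMDiff_eval_manifold (i : ι) :
    ContMDiff (ModelWithCorners.pi fun _ : ι => J) J ∞ (fun x : ι → N => x i) := by
  intro x
  refine contMDiffAt_iff.2 ⟨(continuous_apply i).continuousAt, ?_⟩
  refine (contDiff_apply ℝ E' i).contDiffWithinAt.congr_of_eventuallyEq_of_mem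
    ?_ (mem_range_self _)
  filter_upwards [extChartAt_target_mem_nhdsWithin
    (I := ModelWithCorners.pi fun _ : ι => J) x] with z hz
  exact congrFun ((extChartAt (ModelWithCorners.pi fun _ : ι => J) x).right_inv hz) i

theorem SmoothOnSubset.pi {f : S → ι → N} (hf : ∀ i, SmoothOnSubset I J S (fun x => f x i)) :
    SmoothOnSubset I (ModelWithCorners.pi fun _ : ι => J) S f := by
  intro x
  choose U hU hxU f' hf' hfU using fun i => hf i x
  refine ⟨⋂ i, U i, isOpen_iInter_of_finite hU, mem_iInter.2 hxU, fun y i => f' i y,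
    contMDiffOn_pi_manifold fun i => (hf' i).mono (iInter_subset U i), fun y hy => ?_⟩
  funext i
  exact hfU i y (mem_iInter.1 hy i)

end Pi

end SmoothOnSubset

/-! ### Lie groupoids -/

/-- A Lie groupoid `Arr ⇉ Obj`: a groupoid whose objects and arrows form smooth manifolds, whose
structure maps are smooth, and whose source and target are submersions. The manifold of objects is
Hausdorff and second countable; the manifold of arrows need not be. The arrow `mul ⟨(g, h), _⟩` is
the composite `g h`, defined when `src g = tgt h`. -/
structure LieGroupoid where
  /-- the objects -/
  Obj : Type u
  /-- the arrows -/
  Arr : Type u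
  /-- the dimension of the manifold of objects -/
  dimObj : ℕ
  /-- the dimension of the manifold of arrows -/
  dimArr : ℕ
  [topObj : TopologicalSpace Obj]
  [t2Obj : T2Space Obj]
  [sndObj : SecondCountableTopology Obj]
  [chartedObj : ChartedSpace (EuclideanSpace ℝ (Fin dimObj)) Obj]
  [manifoldObj : IsManifold (𝓡 dimObj) ∞ Obj]
  [topArr : TopologicalSpace Arr]
  [chartedArr : ChartedSpace (EuclideanSpace ℝ (Fin dimArr)) Arr]
  [manifoldArr : IsManifold (𝓡 dimArr) ∞ Arr]
  /-- the source map -/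
  src : Arr → Obj
  /-- the target map -/
  tgt : Arr → Obj
  /-- the identity arrows -/
  unit : Obj → Arr
  /-- the inversion -/
  inv : Arr → Arr
  /-- the multiplication of composable arrows -/
  mul : {p : Arr × Arr | src p.1 = tgt p.2} → Arr
  src_unit : ∀ x, src (unit x) = x
  tgt_unit : ∀ x, tgt (unit x) = x
  src_inv : ∀ g, src (inv g) = tgt g
  tgt_inv : ∀ g, tgt (inv g) = src g
  src_mul : ∀ p, src (mul p) = src p.1.2
  tgt_mul : ∀ p, tgt (mul p) = tgt p.1.1
  mul_assoc : ∀ (g h k : Arr) (hgh : src g = tgt h) (hhk : src h = tgt k),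
    mul ⟨(mul ⟨(g, h), hgh⟩, k), (src_mul ⟨(g, h), hgh⟩).trans hhk⟩ =
      mul ⟨(g, mul ⟨(h, k), hhk⟩), hgh.trans (tgt_mul ⟨(h, k), hhk⟩).symm⟩
  mul_unit : ∀ g, mul ⟨(g, unit (src g)), (tgt_unit _).symm⟩ = g
  unit_mul : ∀ g, mul ⟨(unit (tgt g), g), src_unit _⟩ = g
  mul_inv : ∀ g, mul ⟨(g, inv g), (tgt_inv g).symm⟩ = unit (tgt g)
  inv_mul : ∀ g, mul ⟨(inv g, g), src_inv g⟩ = unit (src g)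
  smooth_src : ContMDiff (𝓡 dimArr) (𝓡 dimObj) ∞ src
  smooth_tgt : ContMDiff (𝓡 dimArr) (𝓡 dimObj) ∞ tgt
  smooth_unit : ContMDiff (𝓡 dimObj) (𝓡 dimArr) ∞ unit
  smooth_inv : ContMDiff (𝓡 dimArr) (𝓡 dimArr) ∞ inv
  smooth_mul : SmoothOnSubset ((𝓡 dimArr).prod (𝓡 dimArr)) (𝓡 dimArr) _ mul
  submersion_src : ∀ g, Surjective (mfderiv (𝓡 dimArr) (𝓡 dimObj) src g)
  submersion_tgt : ∀ g, Surjective (mfderiv (𝓡 dimArr) (𝓡 dimObj) tgt g)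

namespace LieGroupoid

attribute [instance] topObj t2Obj sndObj chartedObj manifoldObj topArr chartedArr manifoldArr

/-! ### Weak equivalences and Morita equivalence -/

/-- A homomorphism of Lie groupoids `H → G`. -/
structure Hom (H G : LieGroupoid.{u}) where
  /-- the map on objects -/
  obj : H.Obj → G.Obj
  /-- the map on arrows -/
  arr : H.Arr → G.Arr
  smooth_obj : ContMDiff (𝓡 H.dimObj) (𝓡 G.dimObj) ∞ obj
  smooth_arr : ContMDiff (𝓡 H.dimArr) (𝓡 G.dimArr) ∞ arr
  src_arr : ∀ h, G.src (arr h) = obj (H.src h)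
  tgt_arr : ∀ h, G.tgt (arr h) = obj (H.tgt h)
  map_mul : ∀ p : {p : H.Arr × H.Arr | H.src p.1 = H.tgt p.2},
    arr (H.mul p) = G.mul ⟨(arr p.1.1, arr p.1.2),
      ((src_arr _).trans (congrArg obj p.2)).trans (tgt_arr _).symm⟩

/-- A smooth map `f : N → G.Obj` is smoothly essentially surjective if `(g, x) ↦ tgt g`, from the
fibre product `{(g, x) | src g = f x}` of `src` and `f` to `G.Obj`, is a surjective submersion. The
tangent space of the fibre product at `(g, x)` consists of the pairs of tangent vectors `(u, v)`
with `d(src)(u) = df(v)`. -/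
def SmoothlyEssentiallySurjective (G : LieGroupoid.{u}) {d : ℕ} {N : Type u} [TopologicalSpace N]
    [ChartedSpace (EuclideanSpace ℝ (Fin d)) N] (f : N → G.Obj) : Prop :=
  (∀ y : G.Obj, ∃ (g : G.Arr) (x : N), G.src g = f x ∧ G.tgt g = y) ∧
  ∀ (g : G.Arr) (x : N), G.src g = f x → ∀ w : TangentSpace (𝓡 G.dimObj) (G.tgt g),
    ∃ (u : TangentSpace (𝓡 G.dimArr) g) (v : TangentSpace (𝓡 d) x),
      tangentMap (𝓡 G.dimArr) (𝓡 G.dimObj) G.src ⟨g, u⟩ =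
        tangentMap (𝓡 d) (𝓡 G.dimObj) f ⟨x, v⟩ ∧
      mfderiv (𝓡 G.dimArr) (𝓡 G.dimObj) G.tgt g u = w

/-- The arrows `N ×_{f, tgt} G.Arr ×_{src, f} N` of the pullback groupoid of `G` along
`f : N → G.Obj`. -/
def pullbackArr (G : LieGroupoid.{u}) {N : Type u} (f : N → G.Obj) : Set (N × G.Arr × N) :=
  {p | f p.1 = G.tgt p.2.1 ∧ G.src p.2.1 = f p.2.2}

variable {G H : LieGroupoid.{u}}

/-- The natural map `h ↦ (tgt h, F h, src h)` from `H` to the pullback groupoid of `G` along the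
object map of `F : H → G`, on arrows. -/
def Hom.toPullback (F : Hom H G) (h : H.Arr) : G.pullbackArr F.obj :=
  ⟨(H.tgt h, F.arr h, H.src h), (F.tgt_arr h).symm, F.src_arr h⟩

/-- A homomorphism `F : H → G` is a weak equivalence if it is smoothly essentially surjective on
objects and the natural map from `H` to the pullback groupoid of `G` is an isomorphism of Lie
groupoids, that is, on arrows (where it is smooth) it is bijective with smooth inverse. -/
def Hom.IsWeakEquivalence (F : Hom H G) : Prop :=
  G.SmoothlyEssentiallySurjective (d := H.dimObj) F.obj ∧
  ∃ K : G.pullbackArr F.obj → H.Arr, LeftInverse K F.toPullback ∧ RightInverse K F.toPullback ∧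
    SmoothOnSubset ((𝓡 H.dimObj).prod ((𝓡 G.dimArr).prod (𝓡 H.dimObj))) (𝓡 H.dimArr)
      (G.pullbackArr F.obj) K

/-- Two Lie groupoids are Morita equivalent if they are joined by a finite zig-zag of weak
equivalences. -/
def MoritaEquivalent (G H : LieGroupoid.{u}) : Prop :=
  Relation.EqvGen (fun A B : LieGroupoid.{u} => ∃ F : Hom A B, F.IsWeakEquivalence) G H

/-! ### The nerve and the groupoid cochain complex -/

/-- The manifold in which the strings of `n` arrows and their `n + 1` objects live. -/
abbrev NerveAmbient (G : LieGroupoid.{u}) (n : ℕ) : Type u := (Fin (n + 1) → G.Obj) × (Fin n → G.Arr)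

/-- The product smooth structure of `G.NerveAmbient n`. -/
noncomputable abbrev nerveModel (G : LieGroupoid.{u}) (n : ℕ) :=
  (ModelWithCorners.pi fun _ : Fin (n + 1) => 𝓡 G.dimObj).prod
    (ModelWithCorners.pi fun _ : Fin n => 𝓡 G.dimArr)

/-- The space of strings of `n` composable arrows `x₀ → x₁ → ⋯ → xₙ`, where the `i`-th arrow goes
from `xᵢ` to `xᵢ₊₁`. For `n = 0` this is the space of objects; for `n ≥ 1` the objects are
determined by the arrows through `src` and `tgt`. -/
def nerve (G : LieGroupoid.{u}) (n : ℕ) : Set (G.NerveAmbient n) :=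
  {p | ∀ i : Fin n, G.src (p.2 i) = p.1 i.castSucc ∧ G.tgt (p.2 i) = p.1 i.succ}

theorem nerve_composable {n : ℕ} (p : G.nerve (n + 1)) (j : Fin n) :
    G.src (p.1.2 j.succ) = G.tgt (p.1.2 j.castSucc) :=
  (p.2 j.succ).1.trans (p.2 j.castSucc).2.symm

/-- The `j`-th arrow of the `i`-th face of a string of `n + 1` arrows. -/
def faceArr {n : ℕ} (i : Fin (n + 2)) (p : G.nerve (n + 1)) (j : Fin n) : G.Arr :=
  if (j : ℕ) + 1 < i then p.1.2 j.castSucc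
  else if (j : ℕ) + 1 = i then G.mul ⟨(p.1.2 j.succ, p.1.2 j.castSucc), nerve_composable p j⟩
  else p.1.2 j.succ

/-- The `i`-th face of a string of `n + 1` arrows: the object `xᵢ` is removed, and the two arrows
adjacent to it are composed (if `0 < i < n + 1`) or the one arrow adjacent to it is removed (if
`i = 0` or `i = n + 1`). -/
def face {n : ℕ} (i : Fin (n + 2)) (p : G.nerve (n + 1)) : G.nerve n :=
  ⟨(fun j => p.1.1 (i.succAbove j), faceArr i p), by
    intro j
    have h1 := p.2 j.castSucc
    have h2 := p.2 j.succ
    have e1 : (j : ℕ) + 1 ≤ i → i.succAbove j.castSucc = j.castSucc.castSucc := fun h =>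
      Fin.succAbove_of_castSucc_lt _ _ (by simp [Fin.lt_def]; omega)
    have e2 : ¬ (j : ℕ) + 1 ≤ i → i.succAbove j.castSucc = j.castSucc.succ := fun h =>
      Fin.succAbove_of_le_castSucc _ _ (by simp [Fin.le_def]; omega)
    have e3 : (j : ℕ) + 1 < i → i.succAbove j.succ = j.succ.castSucc := fun h =>
      Fin.succAbove_of_castSucc_lt _ _ (by simpa [Fin.lt_def] using h)
    have e4 : ¬ (j : ℕ) + 1 < i → i.succAbove j.succ = j.succ.succ := fun h =>
      Fin.succAbove_of_le_castSucc _ _ (by simpa [Fin.le_def] using h)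
    simp only [faceArr]
    split_ifs with ha hb
    · rw [e1 ha.le, e3 ha, ← Fin.succ_castSucc]
      exact h1
    · rw [e1 hb.le, e4 ha, G.src_mul, G.tgt_mul]
      exact ⟨h1.1, h2.2⟩
    · rw [e2 (by omega), e4 ha, Fin.succ_castSucc]
      exact h2⟩

theorem nerve_ext {n : ℕ} {p q : G.nerve n} (h1 : ∀ j, p.1.1 j = q.1.1 j)
    (h2 : ∀ j, p.1.2 j = q.1.2 j) : p = q :=
  Subtype.ext (Prod.ext (funext h1) (funext h2))

theorem face_face {n : ℕ} (i j : Fin (n + 2)) (hij : i ≤ j) (p : G.nerve (n + 2)) :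
    face i (face j.succ p) = face j (face i.castSucc p) := by
  have hij' : (i : ℕ) ≤ j := hij
  refine nerve_ext (fun k => ?_) (fun k => ?_)
  · refine congrArg p.1.1 (Fin.ext ?_)
    simp only [Fin.succAbove, Fin.lt_def, Fin.val_castSucc, Fin.val_succ]
    split_ifs <;> simp at * <;> omega
  · change faceArr i (face j.succ p) k = faceArr j (face i.castSucc p) k
    have hk : ∀ (q : G.nerve (n + 2)) (l : Fin (n + 3)) (m : Fin (n + 1)),
      (face l q).1.2 m = faceArr l q m := fun _ _ _ => rfl
    simp only [faceArr, hk, Fin.val_castSucc, Fin.val_succ]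
    split_ifs
    all_goals first
      | rfl
      | omega
      | exact (if_pos (show (k : ℕ) + 1 < j by omega)).symm
      | skip
    rw [if_neg (show ¬ (k : ℕ) + 1 < j by omega), if_pos (show (k : ℕ) + 1 = j by omega)]
    simp only [show ¬ (k : ℕ) + 1 + 1 < i by omega, show ¬ (k : ℕ) + 1 + 1 = i by omega, if_false]
    exact G.mul_assoc (p.1.2 k.succ.succ) (p.1.2 k.succ.castSucc) (p.1.2 k.castSucc.castSucc) _ _

theorem smooth_face {n : ℕ} (i : Fin (n + 2)) :
    SmoothOnSubset (G.nerveModel (n + 1)) (G.nerveModel n) (G.nerve (n + 1))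
      (fun p => (face i p : G.NerveAmbient n)) := by
  have hobj : ∀ k : Fin (n + 2), SmoothOnSubset (G.nerveModel (n + 1)) (𝓡 G.dimObj)
      (G.nerve (n + 1)) (fun p => p.1.1 k) := fun k =>
    SmoothOnSubset.of_contMDiff ((contMDiff_eval_manifold k).comp contMDiff_fst)
  have harr : ∀ k : Fin (n + 1), SmoothOnSubset (G.nerveModel (n + 1)) (𝓡 G.dimArr)
      (G.nerve (n + 1)) (fun p => p.1.2 k) := fun k =>
    SmoothOnSubset.of_contMDiff ((contMDiff_eval_manifold k).comp contMDiff_snd)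
  refine SmoothOnSubset.prodMk (SmoothOnSubset.pi fun j => hobj _)
    (SmoothOnSubset.pi fun j => ?_)
  change SmoothOnSubset _ _ _ (fun p : G.nerve (n + 1) => faceArr i p j)
  simp only [faceArr]
  split_ifs
  · exact harr _
  · exact G.smooth_mul.comp (g := fun p : G.nerve (n + 1) =>
      ⟨(p.1.2 j.succ, p.1.2 j.castSucc), nerve_composable p j⟩) ((harr _).prodMk (harr _))
  · exact harr _

/-- The smooth functions on the space of strings of `n` composable arrows. -/
def Cochain (G : LieGroupoid.{u}) (n : ℕ) : Submodule ℝ (G.nerve n → ℝ) where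
  carrier := {f | SmoothOnSubset (G.nerveModel n) 𝓘(ℝ, ℝ) (G.nerve n) f}
  zero_mem' := SmoothOnSubset.of_contMDiff (f' := fun _ => (0 : ℝ)) contMDiff_const
  add_mem' hf hg := SmoothOnSubset.contMDiff_comp (J := 𝓘(ℝ, ℝ).prod 𝓘(ℝ, ℝ))
    (h := fun z : ℝ × ℝ => z.1 + z.2)
    (contMDiff_fst.add contMDiff_snd) (SmoothOnSubset.prodMk hf hg)
  smul_mem' c _ hf := SmoothOnSubset.contMDiff_comp (J := 𝓘(ℝ, ℝ)) (h := fun z : ℝ => c * z)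
    (contMDiff_const.mul contMDiff_id) hf

/-- The pullback of cochains along the `i`-th face map. -/
def coface {n : ℕ} (i : Fin (n + 2)) : G.Cochain n →ₗ[ℝ] G.Cochain (n + 1) where
  toFun f := ⟨fun p => f.1 (face i p), f.2.comp (smooth_face i)⟩
  map_add' _ _ := rfl
  map_smul' _ _ := rfl

/-- The simplicial differential `δ = ∑ (-1)ⁱ dᵢ^*`. -/
def differential (G : LieGroupoid.{u}) (n : ℕ) : G.Cochain n →ₗ[ℝ] G.Cochain (n + 1) :=
  ∑ i : Fin (n + 2), (-1 : ℝ) ^ (i : ℕ) • coface i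

theorem differential_apply (n : ℕ) (f : G.Cochain n) (p : G.nerve (n + 1)) :
    (G.differential n f).1 p = ∑ i : Fin (n + 2), (-1 : ℝ) ^ (i : ℕ) * f.1 (face i p) := by
  simp [differential, coface]

theorem differential_differential (n : ℕ) (f : G.Cochain n) :
    G.differential (n + 1) (G.differential n f) = 0 := by
  apply Subtype.ext
  funext p
  have key : ∑ j : Fin (n + 3), ∑ i : Fin (n + 2),
      (-1 : ℝ) ^ (j : ℕ) * ((-1 : ℝ) ^ (i : ℕ) * f.1 (face i (face j p))) = 0 := by
    rw [← Finset.sum_product', Finset.univ_product_univ]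
    refine Finset.sum_involution (fun ji _ =>
      if h : (ji.1 : ℕ) ≤ ji.2 then (ji.2.succ, ji.1.castLT (lt_of_le_of_lt h ji.2.2))
      else (ji.2.castSucc, ji.1.pred fun h0 => h (by simp [h0]))) ?_ ?_ ?_ ?_
    · rintro ⟨j, i⟩ -
      dsimp only
      split_ifs with h
      · have e := face_face (j.castLT (lt_of_le_of_lt h i.2)) i h p
        rw [Fin.castSucc_castLT] at e
        simp only [e, Fin.val_succ, Fin.val_castLT]
        ring
      · obtain ⟨j, rfl⟩ := Fin.exists_succ_eq.2 (show j ≠ 0 from fun h0 => h (by simp [h0]))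
        have e := face_face i j (Fin.le_def.2 (by have : ¬ ((j : ℕ) + 1 ≤ i) := h; omega)) p
        simp only [e, Fin.val_succ, Fin.pred_succ, Fin.val_castSucc]
        ring
    · rintro ⟨j, i⟩ - -
      dsimp only
      split_ifs with h
      · intro e
        have := congrArg (fun z => (z.1 : ℕ)) e
        simp at this
        omega
      · intro e
        have := congrArg (fun z => (z.1 : ℕ)) e
        simp at this
        omega
    · intros
      exact Finset.mem_univ _
    · rintro ⟨j, i⟩ -
      dsimp only
      split_ifs with h h' h'
      all_goals simp only [Fin.val_succ, Fin.val_castLT, Fin.val_castSucc, Fin.val_pred] at h'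
      · omega
      · rfl
      · simp
      · omega
  simp only [differential_apply, Finset.mul_sum]
  exact key

/-- The groupoid cochain complex of a Lie groupoid, formed by the smooth functions on its nerve with
the simplicial differential. -/
noncomputable def cochainComplex (G : LieGroupoid.{u}) : CochainComplex (ModuleCat.{u} ℝ) ℕ :=
  CochainComplex.of (fun n => ModuleCat.of ℝ (G.Cochain n))
    (fun n => ModuleCat.ofHom (G.differential n)) fun n => by
      refine ModuleCat.hom_ext (LinearMap.ext fun f => ?_)
      exact differential_differential n f

/-- The differentiable cohomology `Hⁿ` of a Lie groupoid, a real vector space. -/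
noncomputable abbrev cohomology (G : LieGroupoid.{u}) (n : ℕ) : ModuleCat.{u} ℝ :=
  G.cochainComplex.homology n

end LieGroupoid

/-! It suffices to treat one weak equivalence `F : H → G` and to show that pullback along `F` is a
homotopy equivalence of cochain complexes; the zig-zag then only composes and inverts isomorphisms.

If every object `y` of `G` had an arrow `F x → y` depending smoothly on `y`, conjugation with these
arrows followed by the inverse `K` of `H → F^*G` would be a smooth quasi-inverse functor `G → H`,
and the usual prism operators would give the homotopies. Such arrows exist only locally: essential
surjectivity is a submersion condition, so the inverse function theorem yields local sections
(`SmoothlyEssentiallySurjective.exists_local_section`).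

Local choices are combined by averaging, which is possible because cochains take values in a vector
space. Each vertex of a string in `G` gets a label naming the local section used there. A labelled
string has an image in `H`, functorially in the labelled vertices, and a cochain on `H` is averaged
over all labellings, vertex `x` having label `i` with weight `ρ i x` for a subordinate partition of
unity `ρ`. The result is smooth because a weight vanishes where its section is not smooth. It
commutes with the differential because a face forgets one vertex, and the weights of the forgotten
label sum to 1.

Both composites with `F^*` are again averages, over conjugation with the chosen arrows in `G`, and
with their lifts in `H`. An extra label `none`, standing for the unit arrows, makes the identity an
average for the same labelled functor. Two labellings of the same vertices span a prism, and
`tuplePrism_homotopy`, averaged, is the required homotopy. To make faces and prisms mere operations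
on tuples of labelled vertices, a string is described by the arrows `edge p j k` between any two of
its vertices. -/

/-! ### The prism operator on tuples -/

section Prism

variable {W : Type*} {m : ℕ}

/-- The tuple `(v₀, …, vᵢ, wᵢ, …, wₘ₋₁)`. -/
def prismTuple (v w : Fin m → W) (i : Fin m) (j : Fin (m + 1)) : W :=
  if j ≤ i.castSucc then v (i.predAbove j) else w (i.predAbove j)

theorem prismTuple_cons_zero (a b : W) (v w : Fin m → W) :
    prismTuple (Fin.cons a v : Fin (m + 1) → W) (Fin.cons b w) 0 =
      Fin.cons a (Fin.cons b w : Fin (m + 1) → W) := by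
  funext j
  refine Fin.cases ?_ (fun j => ?_) j
  · simp [prismTuple]
  · simp [prismTuple]

theorem prismTuple_cons_succ (a b : W) (v w : Fin m → W) (i : Fin m) :
    prismTuple (Fin.cons a v : Fin (m + 1) → W) (Fin.cons b w) i.succ =
      Fin.cons a (prismTuple v w i) := by
  funext j
  refine Fin.cases ?_ (fun j => ?_) j
  · simp [prismTuple]
  · simp [prismTuple]

/-- The simplicial differential on functions of tuples. -/
def tupleDifferential (c : (Fin m → W) → ℝ) (v : Fin (m + 1) → W) : ℝ :=
  ∑ i : Fin (m + 1), (-1 : ℝ) ^ (i : ℕ) * c (v ∘ i.succAbove)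

/-- The alternating sum of a function over the prism between two tuples. -/
def tuplePrism (c : (Fin (m + 1) → W) → ℝ) (v w : Fin m → W) : ℝ :=
  ∑ i : Fin m, (-1 : ℝ) ^ (i : ℕ) * c (prismTuple v w i)

/-- Omitting the first entry gives `c v`; every other face keeps `a`, with its index, hence its
sign, shifted by one. Together with `tuplePrism_cons` this allows induction on the length of tuples.
-/
theorem tupleDifferential_cons (c : (Fin (m + 1) → W) → ℝ) (a : W) (v : Fin (m + 1) → W) :
    tupleDifferential c (Fin.cons a v : Fin (m + 2) → W) =
      c v - tupleDifferential (fun t => c (Fin.cons a t : Fin (m + 1) → W)) v := by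
  rw [tupleDifferential, Fin.sum_univ_succ, tupleDifferential, sub_eq_add_neg,
    ← Finset.sum_neg_distrib]
  congr 1
  · simp [comp_def]
  · refine Finset.sum_congr rfl fun i _ => ?_
    have e : (Fin.cons a v : Fin (m + 2) → W) ∘ i.succ.succAbove =
        Fin.cons a (v ∘ i.succAbove) := by
      funext j
      refine Fin.cases ?_ (fun j => ?_) j <;> simp
    rw [e, Fin.val_succ, pow_succ]
    ring

theorem tuplePrism_cons (c : (Fin (m + 2) → W) → ℝ) (a b : W) (v w : Fin m → W) :
    tuplePrism c (Fin.cons a v : Fin (m + 1) → W) (Fin.cons b w) =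
      c (Fin.cons a (Fin.cons b w : Fin (m + 1) → W)) -
        tuplePrism (fun t => c (Fin.cons a t : Fin (m + 2) → W)) v w := by
  rw [tuplePrism, Fin.sum_univ_succ, tuplePrism, sub_eq_add_neg, ← Finset.sum_neg_distrib]
  congr 1
  · simp [prismTuple_cons_zero]
  · refine Finset.sum_congr rfl fun i _ => ?_
    rw [prismTuple_cons_succ, Fin.val_succ, pow_succ]
    ring

theorem tuplePrism_sub (c c' : (Fin (m + 1) → W) → ℝ) (v w : Fin m → W) :
    tuplePrism (fun t => c t - c' t) v w = tuplePrism c v w - tuplePrism c' v w := by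
  simp only [tuplePrism, mul_sub, Finset.sum_sub_distrib]

theorem tuplePrism_add (c c' : (Fin (m + 1) → W) → ℝ) (v w : Fin m → W) :
    tuplePrism (fun t => c t + c' t) v w = tuplePrism c v w + tuplePrism c' v w := by
  simp only [tuplePrism, mul_add, Finset.sum_add_distrib]

theorem tuplePrism_const_mul (r : ℝ) (c : (Fin (m + 1) → W) → ℝ) (v w : Fin m → W) :
    tuplePrism (fun t => r * c t) v w = r * tuplePrism c v w := by
  simp only [tuplePrism, Finset.mul_sum, mul_left_comm r]

/-- Induction on the length. With first entries `a`, `b` split off, the prism terms of `c` on the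
tails cancel, and so do the terms `c (a, b, ·)` on the faces of `w`. What remains is `c (b, w) - c
(a, w)` plus the left side for the cochain `c (a, ·)`, which is `c (a, w) - c (a, v)` by induction.
-/
theorem tuplePrism_homotopy : ∀ {m : ℕ} (c : (Fin (m + 1) → W) → ℝ) (v w : Fin (m + 1) → W),
    tuplePrism (tupleDifferential c) v w +
      ∑ j : Fin (m + 1), (-1 : ℝ) ^ (j : ℕ) * tuplePrism c (v ∘ j.succAbove) (w ∘ j.succAbove) =
    c w - c v
  | 0, c, v, w => by
    have e1 : prismTuple v w 0 ∘ Fin.succ = w := by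
      funext j; rw [Subsingleton.elim j 0]; simp [prismTuple]
    have e2 : prismTuple v w 0 ∘ Fin.succAbove 1 = v := by
      funext j; rw [Subsingleton.elim j 0]; simp [prismTuple]
    simp [tuplePrism, tupleDifferential, e1, e2]
    ring
  | m + 1, c, v, w => by
    obtain ⟨a, v, rfl⟩ : ∃ a v', v = Fin.cons a v' := ⟨v 0, Fin.tail v, (Fin.cons_self_tail v).symm⟩
    obtain ⟨b, w, rfl⟩ : ∃ b w', w = Fin.cons b w' := ⟨w 0, Fin.tail w, (Fin.cons_self_tail w).symm⟩
    have ih := tuplePrism_homotopy (fun t => c (Fin.cons a t : Fin (m + 2) → W)) v w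
    rw [tuplePrism_cons, tupleDifferential_cons, tupleDifferential_cons, Fin.sum_univ_succ]
    have e : ∀ (x : W) (v : Fin (m + 1) → W) (i : Fin (m + 1)),
        (Fin.cons x v : Fin (m + 2) → W) ∘ i.succ.succAbove =
          (Fin.cons x (v ∘ i.succAbove) : Fin (m + 1) → W) := by
      intro x v i
      funext j
      refine Fin.cases ?_ (fun j => ?_) j <;> simp
    have e0 : ∀ (x : W) (v : Fin (m + 1) → W),
        (Fin.cons x v : Fin (m + 2) → W) ∘ (0 : Fin (m + 2)).succAbove = v := by
      intro x v
      funext j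
      simp
    have e3 : ∀ i : Fin (m + 1), (-1 : ℝ) ^ (i.succ : ℕ) *
        tuplePrism c ((Fin.cons a v : Fin (m + 2) → W) ∘ i.succ.succAbove)
          ((Fin.cons b w : Fin (m + 2) → W) ∘ i.succ.succAbove) =
        (-1 : ℝ) ^ (i : ℕ) * tuplePrism (fun t => c (Fin.cons a t : Fin (m + 2) → W))
            (v ∘ i.succAbove) (w ∘ i.succAbove) -
        (-1 : ℝ) ^ (i : ℕ) *
          c (Fin.cons a (Fin.cons b (w ∘ i.succAbove) : Fin (m + 1) → W)) := by
      intro i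
      rw [e, e, tuplePrism_cons, Fin.val_succ, pow_succ]
      ring
    simp only [tupleDifferential_cons, tuplePrism_sub, e3, e0, Finset.sum_sub_distrib]
    have e4 : tupleDifferential (fun t => c (Fin.cons a (Fin.cons b t : Fin (m + 1) → W))) w =
      ∑ i : Fin (m + 1), (-1 : ℝ) ^ (i : ℕ) *
          c (Fin.cons a (Fin.cons b (w ∘ i.succAbove) : Fin (m + 1) → W)) := rfl
    rw [← e4]
    simp only [Fin.val_zero, pow_zero, one_mul]
    linarith

end Prism

/-! ### Averages over independent labels -/

section Average

variable {ι : Type*} {n : ℕ}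

/-- The average of `φ (a₀, …, aₙ₋₁)` over independently chosen labels, where `aⱼ` is chosen with
weight `r j aⱼ`. -/
noncomputable def labelAverage (r : Fin n → ι → ℝ) (φ : (Fin n → ι) → ℝ) : ℝ :=
  ∑ᶠ a, (∏ j, r j (a j)) * φ a

/-- A labelling with some label outside `s` has weight zero. Later identities thereby become
manipulations of finite sums. -/
theorem labelAverage_eq_sum {r : Fin n → ι → ℝ} (φ : (Fin n → ι) → ℝ) {s : Finset ι}
    (hs : ∀ j, support (r j) ⊆ s) :
    labelAverage r φ = ∑ a : Fin n → s, (∏ j, r j (a j)) * φ (fun j => a j) := by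
  classical
  rw [labelAverage, finsum_eq_sum_of_support_subset (s := Fintype.piFinset fun _ => s)]
  · refine Finset.sum_bij' (fun a ha j => ⟨a j, Fintype.mem_piFinset.1 ha j⟩) (fun a _ j => a j)
      ?_ ?_ ?_ ?_ ?_ <;> simp
  · intro a ha
    rw [Finset.mem_coe, Fintype.mem_piFinset]
    intro j
    refine hs j fun h0 => ha ?_
    dsimp only
    rw [Finset.prod_eq_zero (Finset.mem_univ j) h0, zero_mul]

theorem exists_finset_support_subset {r : Fin n → ι → ℝ} (hr : ∀ j, (support (r j)).Finite) :
    ∃ s : Finset ι, ∀ j, support (r j) ⊆ s :=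
  ⟨(Set.finite_iUnion hr).toFinset, fun j => by
    rw [Set.Finite.coe_toFinset]
    exact subset_iUnion (fun j => support (r j)) j⟩

theorem labelAverage_add {r : Fin n → ι → ℝ} (hr : ∀ j, (support (r j)).Finite)
    (φ ψ : (Fin n → ι) → ℝ) :
    labelAverage r (fun a => φ a + ψ a) = labelAverage r φ + labelAverage r ψ := by
  obtain ⟨s, hs⟩ := exists_finset_support_subset hr
  simp only [labelAverage_eq_sum _ hs, mul_add, Finset.sum_add_distrib]

theorem labelAverage_mul_left {r : Fin n → ι → ℝ} (hr : ∀ j, (support (r j)).Finite) (c : ℝ)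
    (φ : (Fin n → ι) → ℝ) :
    labelAverage r (fun a => c * φ a) = c * labelAverage r φ := by
  obtain ⟨s, hs⟩ := exists_finset_support_subset hr
  simp only [labelAverage_eq_sum _ hs, Finset.mul_sum]
  exact Finset.sum_congr rfl fun a _ => by ring

theorem labelAverage_sum {r : Fin n → ι → ℝ} (hr : ∀ j, (support (r j)).Finite) {κ : Type*}
    (t : Finset κ) (φ : κ → (Fin n → ι) → ℝ) :
    labelAverage r (fun a => ∑ k ∈ t, φ k a) = ∑ k ∈ t, labelAverage r (φ k) := by
  obtain ⟨s, hs⟩ := exists_finset_support_subset hr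
  simp only [labelAverage_eq_sum _ hs, Finset.mul_sum]
  exact Finset.sum_comm

theorem sum_coe_eq_one {r : ι → ℝ} {s : Finset ι} (hs : support r ⊆ s) (h1 : ∑ᶠ i, r i = 1) :
    ∑ i : s, r i = 1 := by
  rw [← h1, finsum_eq_sum_of_support_subset _ hs]
  exact Finset.sum_coe_sort s r

theorem labelAverage_const {r : Fin n → ι → ℝ} (hr : ∀ j, (support (r j)).Finite)
    (h1 : ∀ j, ∑ᶠ i, r j i = 1) (c : ℝ) :
    labelAverage r (fun _ => c) = c := by
  classical
  obtain ⟨s, hs⟩ := exists_finset_support_subset hr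
  rw [labelAverage_eq_sum _ hs, ← Finset.sum_mul,
    ← Fintype.prod_sum (f := fun (j : Fin n) (i : s) => r j i),
    Finset.prod_eq_one fun j _ => sum_coe_eq_one (hs j) (h1 j), one_mul]

/-- A label on which the averaged function does not depend may be omitted. -/
theorem labelAverage_succAbove {r : Fin (n + 1) → ι → ℝ} (hr : ∀ j, (support (r j)).Finite)
    (i : Fin (n + 1)) (h1 : ∑ᶠ a, r i a = 1) (φ : (Fin n → ι) → ℝ) :
    labelAverage r (fun a => φ (a ∘ i.succAbove)) = labelAverage (r ∘ i.succAbove) φ := by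
  classical
  obtain ⟨s, hs⟩ := exists_finset_support_subset hr
  -- A labelling is split into its `i`-th label `x` and the remaining labels; the sum over `x` then
  -- factors out as the total weight 1.
  rw [labelAverage_eq_sum _ hs, labelAverage_eq_sum (r := r ∘ i.succAbove) _ fun j => hs _,
    ← (Fin.insertNthEquiv (fun _ => s) i).sum_comp, Fintype.sum_prod_type, Finset.sum_comm]
  refine Finset.sum_congr rfl fun a _ => ?_
  have e : ∀ x : s, (∏ j, r j ((Fin.insertNthEquiv (fun _ => s) i) (x, a) j)) *
      φ ((fun j => ((Fin.insertNthEquiv (fun _ => s) i) (x, a) j : ι)) ∘ i.succAbove) =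
      r i x * ((∏ j, r (i.succAbove j) (a j)) * φ fun j => a j) := by
    intro x
    rw [Fin.prod_univ_succAbove _ i, ← mul_assoc]
    simp [comp_def]
  rw [Finset.sum_congr rfl fun x _ => e x, ← Finset.sum_mul, sum_coe_eq_one (hs i) h1, one_mul]
  rfl

end Average

namespace LieGroupoid

variable {G H : LieGroupoid.{u}}

/-! ### Total composition of arrows -/

section Comp

open Classical in
/-- The composite of two arrows, with a junk value if they are not composable. -/
noncomputable def comp (G : LieGroupoid.{u}) (g h : G.Arr) : G.Arr :=
  if e : G.src g = G.tgt h then G.mul ⟨(g, h), e⟩ else g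

variable {g h k : G.Arr}

theorem comp_eq_mul (e : G.src g = G.tgt h) : G.comp g h = G.mul ⟨(g, h), e⟩ := dif_pos e

theorem src_comp (e : G.src g = G.tgt h) : G.src (G.comp g h) = G.src h := by
  rw [comp_eq_mul e, G.src_mul]

theorem tgt_comp (e : G.src g = G.tgt h) : G.tgt (G.comp g h) = G.tgt g := by
  rw [comp_eq_mul e, G.tgt_mul]

theorem comp_assoc (e : G.src g = G.tgt h) (e' : G.src h = G.tgt k) :
    G.comp (G.comp g h) k = G.comp g (G.comp h k) := by
  rw [comp_eq_mul (by rw [src_comp e, e']), comp_eq_mul (h := G.comp h k) (by rw [tgt_comp e', e])]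
  simp only [comp_eq_mul e, comp_eq_mul e']
  exact G.mul_assoc g h k e e'

theorem comp_unit {x : G.Obj} (e : G.src g = x) : G.comp g (G.unit x) = g := by
  subst e
  rw [comp_eq_mul (G.tgt_unit _).symm, G.mul_unit]

theorem unit_comp {x : G.Obj} (e : G.tgt g = x) : G.comp (G.unit x) g = g := by
  subst e
  rw [comp_eq_mul (G.src_unit _), G.unit_mul]

theorem comp_inv (g : G.Arr) : G.comp g (G.inv g) = G.unit (G.tgt g) := by
  rw [comp_eq_mul (G.tgt_inv g).symm, G.mul_inv]

theorem inv_comp (g : G.Arr) : G.comp (G.inv g) g = G.unit (G.src g) := by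
  rw [comp_eq_mul (G.src_inv g), G.inv_mul]

theorem inv_comp_cancel (e : G.src g = G.tgt h) : G.comp (G.inv g) (G.comp g h) = h := by
  rw [← comp_assoc (G.src_inv g) e, inv_comp, unit_comp e.symm]

theorem comp_inv_cancel (e : G.tgt g = G.tgt h) : G.comp g (G.comp (G.inv g) h) = h := by
  rw [← comp_assoc (G.tgt_inv g).symm ((G.src_inv g).trans e), comp_inv, unit_comp e.symm]

theorem inv_eq_of_comp_eq_unit {x : G.Obj} (e : G.src g = G.tgt h)
    (hu : G.comp g h = G.unit x) : G.inv g = h := by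
  have hx : G.tgt g = x := by rw [← tgt_comp e, hu, G.tgt_unit]
  rw [← inv_comp_cancel e, hu, comp_unit ((G.src_inv g).trans hx)]

theorem eq_unit_of_comp_self (e : G.src g = G.tgt g) (hg : G.comp g g = g) :
    g = G.unit (G.src g) := by
  conv_lhs => rw [← inv_comp_cancel e, hg, inv_comp]

theorem inv_unit (x : G.Obj) : G.inv (G.unit x) = G.unit x :=
  inv_eq_of_comp_eq_unit (x := x) ((G.src_unit x).trans (G.tgt_unit x).symm)
    (unit_comp (G.tgt_unit x))

theorem Hom.map_comp (F : Hom H G) {g h : H.Arr} (e : H.src g = H.tgt h) :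
    F.arr (H.comp g h) = G.comp (F.arr g) (F.arr h) := by
  rw [comp_eq_mul e, F.map_mul, comp_eq_mul]

/-- A homomorphism is only required to respect multiplication; the image of a unit is idempotent,
and an idempotent in a groupoid is a unit. -/
theorem Hom.map_unit (F : Hom H G) (x : H.Obj) : F.arr (H.unit x) = G.unit (F.obj x) := by
  have hs : G.src (F.arr (H.unit x)) = F.obj x := by rw [F.src_arr, H.src_unit]
  have ht : G.tgt (F.arr (H.unit x)) = F.obj x := by rw [F.tgt_arr, H.tgt_unit]
  have h := eq_unit_of_comp_self (hs.trans ht.symm) (by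
    rw [← F.map_comp ((H.src_unit x).trans (H.tgt_unit x).symm), unit_comp (H.tgt_unit x)])
  rw [h, hs]

theorem Hom.map_inv (F : Hom H G) (g : H.Arr) : F.arr (H.inv g) = G.inv (F.arr g) := by
  refine (inv_eq_of_comp_eq_unit (x := F.obj (H.tgt g)) ?_ ?_).symm
  · rw [F.src_arr, F.tgt_arr, H.tgt_inv]
  · rw [← F.map_comp (H.tgt_inv g).symm, comp_inv, F.map_unit]

/-- The arrow `b⁻¹ g a`. -/
noncomputable def conj (G : LieGroupoid.{u}) (b g a : G.Arr) : G.Arr :=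
  G.comp (G.inv b) (G.comp g a)

variable {a b c : G.Arr}

theorem src_conj (ea : G.src g = G.tgt a) (eb : G.tgt b = G.tgt g) :
    G.src (G.conj b g a) = G.src a := by
  rw [conj, src_comp (by rw [G.src_inv, tgt_comp ea, eb]), src_comp ea]

theorem tgt_conj (ea : G.src g = G.tgt a) (eb : G.tgt b = G.tgt g) :
    G.tgt (G.conj b g a) = G.src b := by
  rw [conj, tgt_comp (by rw [G.src_inv, tgt_comp ea, eb]), G.tgt_inv]

theorem Hom.map_conj (F : Hom H G) {a b g : H.Arr} (ea : H.src g = H.tgt a)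
    (eb : H.tgt b = H.tgt g) :
    F.arr (H.conj b g a) = G.conj (F.arr b) (F.arr g) (F.arr a) := by
  rw [conj, F.map_comp (by rw [H.src_inv, tgt_comp ea, eb]), F.map_comp ea, F.map_inv, conj]

theorem conj_comp_conj (ea : G.src h = G.tgt a) (eb : G.tgt b = G.tgt h)
    (eb' : G.src g = G.tgt b) (ec : G.tgt c = G.tgt g) :
    G.comp (G.conj c g b) (G.conj b h a) = G.conj c (G.comp g h) a := by
  have e1 : G.src (G.inv c) = G.tgt (G.comp g b) := by rw [G.src_inv, tgt_comp eb', ec]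
  have e2 : G.src (G.inv b) = G.tgt (G.comp h a) := by rw [G.src_inv, tgt_comp ea, eb]
  have e3 : G.src b = G.tgt (G.comp (G.inv b) (G.comp h a)) := by rw [tgt_comp e2, G.tgt_inv]
  rw [conj, conj, conj, comp_assoc e1 ((src_comp eb').trans e3), comp_assoc eb' e3,
    comp_inv_cancel (by rw [eb, tgt_comp ea]), comp_assoc (eb'.trans eb) ea]

theorem conj_unit {x y : G.Obj} (hx : G.src g = x) (hy : G.tgt g = y) :
    G.conj (G.unit y) g (G.unit x) = g := by
  rw [conj, comp_unit hx, inv_unit, unit_comp hy]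

end Comp

/-! ### Arrows between arbitrary vertices of a string -/

section Nerve

variable {n m : ℕ}

/-- The composite `x₀ → xⱼ` of the first `j` arrows of a string. -/
noncomputable def path (p : G.nerve n) (j : Fin (n + 1)) : G.Arr :=
  Fin.induction (motive := fun _ => G.Arr) (G.unit (p.1.1 0)) (fun i k => G.comp (p.1.2 i) k) j

theorem path_zero (p : G.nerve n) : path p 0 = G.unit (p.1.1 0) := rfl

theorem path_succ (p : G.nerve n) (j : Fin n) :
    path p j.succ = G.comp (p.1.2 j) (path p j.castSucc) := rfl

theorem src_tgt_path (p : G.nerve n) (j : Fin (n + 1)) :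
    G.src (path p j) = p.1.1 0 ∧ G.tgt (path p j) = p.1.1 j := by
  induction j using Fin.induction with
  | zero => exact ⟨G.src_unit _, G.tgt_unit _⟩
  | succ j ih =>
    have e : G.src (p.1.2 j) = G.tgt (path p j.castSucc) := (p.2 j).1.trans ih.2.symm
    exact ⟨(src_comp e).trans ih.1, (tgt_comp e).trans (p.2 j).2⟩

/-- The arrow `xⱼ → xₖ` between two vertices of a string. -/
noncomputable def edge (p : G.nerve n) (j k : Fin (n + 1)) : G.Arr :=
  G.comp (path p k) (G.inv (path p j))

theorem path_inv_composable (p : G.nerve n) (j k : Fin (n + 1)) :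
    G.src (path p k) = G.tgt (G.inv (path p j)) := by
  rw [G.tgt_inv, (src_tgt_path p k).1, (src_tgt_path p j).1]

theorem src_edge (p : G.nerve n) (j k : Fin (n + 1)) : G.src (edge p j k) = p.1.1 j := by
  rw [edge, src_comp (path_inv_composable p j k), G.src_inv, (src_tgt_path p j).2]

theorem tgt_edge (p : G.nerve n) (j k : Fin (n + 1)) : G.tgt (edge p j k) = p.1.1 k := by
  rw [edge, tgt_comp (path_inv_composable p j k), (src_tgt_path p k).2]

theorem edge_composable (p : G.nerve n) (j k l : Fin (n + 1)) :
    G.src (edge p k l) = G.tgt (edge p j k) := by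
  rw [src_edge, tgt_edge]

theorem edge_comp_edge (p : G.nerve n) (j k l : Fin (n + 1)) :
    G.comp (edge p k l) (edge p j k) = edge p j l := by
  have e := path_inv_composable p
  rw [edge, edge, edge, comp_assoc (e k l) (by rw [G.src_inv, tgt_comp (e j k)]),
    inv_comp_cancel (e j k)]

theorem edge_castSucc_succ (p : G.nerve n) (j : Fin n) : edge p j.castSucc j.succ = p.1.2 j := by
  have e : G.src (p.1.2 j) = G.tgt (path p j.castSucc) :=
    (p.2 j).1.trans (src_tgt_path p _).2.symm
  rw [edge, path_succ, comp_assoc e (G.tgt_inv _).symm, comp_inv, comp_unit e]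

/-- The arrows between the vertices of a string are determined by functoriality. -/
theorem edge_eq_of_functorial (p : G.nerve n) (t : Fin (n + 1) → Fin (n + 1) → G.Arr)
    (hs : ∀ j k, G.src (t j k) = p.1.1 j) (ht : ∀ j k, G.tgt (t j k) = p.1.1 k)
    (hc : ∀ j k l, G.comp (t k l) (t j k) = t j l)
    (hp : ∀ j : Fin n, t j.castSucc j.succ = p.1.2 j) (j k : Fin (n + 1)) :
    edge p j k = t j k := by
  have h0 : ∀ j, t j j = G.unit (p.1.1 j) := fun j => by
    rw [eq_unit_of_comp_self ((hs j j).trans (ht j j).symm) (hc j j j), hs]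
  -- A functorial family is determined by its consecutive arrows: they give all arrows out of vertex
  -- 0, and the rest are quotients of these.
  have hpath : ∀ j, path p j = t 0 j := by
    intro j
    induction j using Fin.induction with
    | zero => rw [path_zero, h0]
    | succ j ih => rw [path_succ, ih, ← hp, hc]
  have hinv : G.inv (t 0 j) = t j 0 :=
    inv_eq_of_comp_eq_unit ((hs _ _).trans (ht _ _).symm) ((hc j 0 j).trans (h0 j))
  rw [edge, hpath, hpath, hinv, hc]

/-- This absorbs the three cases in the definition of a face: in each, the new arrow is the one
joining the two surviving neighbours. -/
theorem faceArr_eq_edge (i : Fin (n + 2)) (p : G.nerve (n + 1)) (j : Fin n) :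
    faceArr i p j = edge p (i.succAbove j.castSucc) (i.succAbove j.succ) := by
  have e1 : (j : ℕ) + 1 ≤ i → i.succAbove j.castSucc = j.castSucc.castSucc := fun h =>
    Fin.succAbove_of_castSucc_lt _ _ (by simp [Fin.lt_def]; omega)
  have e2 : ¬ (j : ℕ) + 1 ≤ i → i.succAbove j.castSucc = j.succ.castSucc := fun h =>
    Fin.succAbove_of_le_castSucc _ _ (by simp [Fin.le_def]; omega)
  have e3 : (j : ℕ) + 1 < i → i.succAbove j.succ = j.castSucc.succ := fun h =>
    Fin.succAbove_of_castSucc_lt _ _ (by simpa [Fin.lt_def] using h)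
  have e4 : ¬ (j : ℕ) + 1 < i → i.succAbove j.succ = j.succ.succ := fun h =>
    Fin.succAbove_of_le_castSucc _ _ (by simpa [Fin.le_def] using h)
  rw [faceArr]
  split_ifs with ha hb
  · rw [e1 ha.le, e3 ha, edge_castSucc_succ]
  · rw [e1 hb.le, e4 ha, ← comp_eq_mul, ← edge_castSucc_succ p j.succ,
      ← edge_castSucc_succ p j.castSucc]
    exact edge_comp_edge _ _ _ _
  · rw [e2 (by omega), e4 ha, edge_castSucc_succ]

theorem edge_face (i : Fin (n + 2)) (p : G.nerve (n + 1)) (j k : Fin (n + 1)) :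
    edge (face i p) j k = edge p (i.succAbove j) (i.succAbove k) := by
  refine edge_eq_of_functorial (face i p) (fun j k => edge p (i.succAbove j) (i.succAbove k))
    ?_ ?_ ?_ ?_ j k
  · exact fun j k => src_edge _ _ _
  · exact fun j k => tgt_edge _ _ _
  · exact fun j k l => edge_comp_edge _ _ _ _
  · exact fun j => (faceArr_eq_edge i p j).symm

end Nerve

/-! ### Labelled functors -/

/-- A functor to `H` from the groupoid whose objects are the objects of `G` with a label in `B`, and
whose arrows are those of `G` between the underlying objects. It is smooth on the objects that lie
in the domain of their label. -/
structure LabelledFunctor (G H : LieGroupoid.{u}) (B : Type*) where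
  /-- the map on objects -/
  obj : B → G.Obj → H.Obj
  /-- the map on arrows -/
  arr : B → B → G.Arr → H.Arr
  /-- the domain of smoothness of a label -/
  dom : B → Set G.Obj
  src_arr : ∀ a b g, H.src (arr a b g) = obj a (G.src g)
  tgt_arr : ∀ a b g, H.tgt (arr a b g) = obj b (G.tgt g)
  map_comp : ∀ a b c g h, G.src g = G.tgt h →
    arr a c (G.comp g h) = H.comp (arr b c g) (arr a b h)
  isOpen_dom : ∀ a, IsOpen (dom a)
  smooth_obj : ∀ a, SmoothOnSubset (𝓡 G.dimObj) (𝓡 H.dimObj) (dom a) (fun x => obj a x)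
  smooth_arr : ∀ a b, SmoothOnSubset (𝓡 G.dimArr) (𝓡 H.dimArr)
    {g | G.src g ∈ dom a ∧ G.tgt g ∈ dom b} (fun g => arr a b g)

namespace LabelledFunctor

variable {B : Type*} (L : LabelledFunctor G H B) {n m : ℕ}

/-- The image under a labelled functor of the string `x_{j₀} → ⋯ → x_{jₘ}` with labels
`b₀, …, bₘ`, where `xⱼ` are the vertices of a given string and `u i = (jᵢ, bᵢ)`. -/
noncomputable def nerveMap (p : G.nerve n) (u : Fin (m + 1) → Fin (n + 1) × B) : H.nerve m :=
  ⟨(fun j => L.obj (u j).2 (p.1.1 (u j).1), fun j => L.arr (u j.castSucc).2 (u j.succ).2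
    (edge p (u j.castSucc).1 (u j.succ).1)), fun j => by
      rw [L.src_arr, L.tgt_arr, src_edge, tgt_edge]
      exact ⟨rfl, rfl⟩⟩

theorem edge_nerveMap (p : G.nerve n) (u : Fin (m + 1) → Fin (n + 1) × B) (j k : Fin (m + 1)) :
    edge (L.nerveMap p u) j k = L.arr (u j).2 (u k).2 (edge p (u j).1 (u k).1) := by
  refine edge_eq_of_functorial (L.nerveMap p u)
    (fun j k => L.arr (u j).2 (u k).2 (edge p (u j).1 (u k).1)) ?_ ?_ ?_ (fun j => rfl) j k
  · intro j k
    rw [L.src_arr, src_edge]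
    rfl
  · intro j k
    rw [L.tgt_arr, tgt_edge]
    rfl
  · intro j k l
    rw [← L.map_comp _ _ _ _ _ (edge_composable _ _ _ _), edge_comp_edge]

theorem face_nerveMap (p : G.nerve n) (u : Fin (m + 2) → Fin (n + 1) × B) (i : Fin (m + 2)) :
    face i (L.nerveMap p u) = L.nerveMap p (u ∘ i.succAbove) :=
  nerve_ext (fun _ => rfl) fun j => by
    change faceArr i (L.nerveMap p u) j = _
    rw [faceArr_eq_edge, edge_nerveMap]
    rfl

theorem nerveMap_face (p : G.nerve (n + 1)) (i : Fin (n + 2)) (u : Fin (m + 1) → Fin (n + 1) × B) :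
    L.nerveMap (face i p) u = L.nerveMap p (fun j => (i.succAbove (u j).1, (u j).2)) :=
  nerve_ext (fun _ => rfl) fun j => by
    change L.arr _ _ (edge (face i p) _ _) = _
    rw [edge_face]
    rfl

/-- The image of a string under a labelled functor, for a choice of labels for the vertices. -/
noncomputable def mapString (p : G.nerve n) (b : Fin (n + 1) → B) : H.nerve n :=
  L.nerveMap p fun j => (j, b j)

theorem mapString_arr (p : G.nerve n) (b : Fin (n + 1) → B) (j : Fin n) :
    (L.mapString p b).1.2 j = L.arr (b j.castSucc) (b j.succ) (p.1.2 j) :=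
  congrArg _ (edge_castSucc_succ p j)

end LabelledFunctor

end LieGroupoid

/-! ### Localization of smooth functions on subsets -/

section SmoothOnSubset

variable {E : Type*} [NormedAddCommGroup E] [NormedSpace ℝ E] {H : Type*} [TopologicalSpace H]
  {E' : Type*} [NormedAddCommGroup E'] [NormedSpace ℝ E'] {H' : Type*} [TopologicalSpace H']
  {M : Type*} [TopologicalSpace M] [ChartedSpace H M]
  {N : Type*} [TopologicalSpace N] [ChartedSpace H' N]
  {I : ModelWithCorners ℝ E H} {J : ModelWithCorners ℝ E' H'} {S T : Set M}

namespace SmoothOnSubset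

theorem restrict {f : S → N} (hf : SmoothOnSubset I J S f) (hT : T ⊆ S) :
    SmoothOnSubset I J T (fun x => f ⟨x, hT x.2⟩) :=
  SmoothOnSubset.comp (h := f) (g := fun x : T => ⟨x, hT x.2⟩) hf (of_contMDiff contMDiff_id)

theorem of_contMDiffOn {f : M → N} (hS : IsOpen S) (hf : ContMDiffOn I J ∞ f S) :
    SmoothOnSubset I J S (fun x => f x) :=
  fun x => ⟨S, hS, x.2, f, hf, fun _ _ => rfl⟩

theorem of_locally_eq {f : S → N}
    (hf : ∀ x : S, ∃ U : Set M, IsOpen U ∧ (x : M) ∈ U ∧ ∃ g : S → N, SmoothOnSubset I J S g ∧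
      ∀ y : S, (y : M) ∈ U → g y = f y) : SmoothOnSubset I J S f := by
  intro x
  obtain ⟨U, hU, hxU, g, hg, hgf⟩ := hf x
  obtain ⟨V, hV, hxV, f', hf', hfg⟩ := hg x
  exact ⟨U ∩ V, hU.inter hV, ⟨hxU, hxV⟩, f', hf'.mono inter_subset_right,
    fun y hy => (hfg y hy.2).trans (hgf y hy.1)⟩

theorem add {f g : S → ℝ} (hf : SmoothOnSubset I 𝓘(ℝ, ℝ) S f)
    (hg : SmoothOnSubset I 𝓘(ℝ, ℝ) S g) : SmoothOnSubset I 𝓘(ℝ, ℝ) S (fun x => f x + g x) :=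
  contMDiff_comp (J := 𝓘(ℝ, ℝ).prod 𝓘(ℝ, ℝ)) (h := fun z : ℝ × ℝ => z.1 + z.2)
    (contMDiff_fst.add contMDiff_snd) (prodMk hf hg)

theorem const_mul {f : S → ℝ} (c : ℝ) (hf : SmoothOnSubset I 𝓘(ℝ, ℝ) S f) :
    SmoothOnSubset I 𝓘(ℝ, ℝ) S (fun x => c * f x) :=
  contMDiff_comp (J := 𝓘(ℝ, ℝ)) (h := fun z : ℝ => c * z) (contMDiff_const.mul contMDiff_id) hf

theorem sum {κ : Type*} (s : Finset κ) {f : κ → S → ℝ}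
    (hf : ∀ a, SmoothOnSubset I 𝓘(ℝ, ℝ) S (f a)) :
    SmoothOnSubset I 𝓘(ℝ, ℝ) S (fun x => ∑ a ∈ s, f a x) := by
  classical
  induction s using Finset.induction_on with
  | empty => exact of_contMDiff (f' := fun _ => (0 : ℝ)) contMDiff_const
  | insert a s ha ih =>
    simp only [Finset.sum_insert ha]
    exact (hf a).add ih

/-- Near a point of `O` both factors are smooth; a point outside `O` has the complement of `tsupport
r` as a neighbourhood, where the product is zero whatever `φ` does. -/
theorem mul_of_tsupport_subset {O : Set M} (hO : IsOpen O) {r : M → ℝ}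
    (hr : ContMDiff I 𝓘(ℝ, ℝ) ∞ r) (hrO : tsupport r ⊆ O) {φ : S → ℝ}
    (hφ : SmoothOnSubset I 𝓘(ℝ, ℝ) (S ∩ O) (fun x => φ ⟨x, x.2.1⟩)) :
    SmoothOnSubset I 𝓘(ℝ, ℝ) S (fun x => r x * φ x) := by
  intro x
  by_cases hx : (x : M) ∈ O
  · obtain ⟨U, hU, hxU, f', hf', hfU⟩ := hφ ⟨x, x.2, hx⟩
    refine ⟨U ∩ O, hU.inter hO, ⟨hxU, hx⟩, fun y => r y * f' y,
      hr.contMDiffOn.mul (hf'.mono inter_subset_left), fun y hy => ?_⟩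
    dsimp only
    rw [hfU ⟨y, y.2, hy.2⟩ hy.1]
  · refine ⟨(tsupport r)ᶜ, (isClosed_tsupport r).isOpen_compl, fun h => hx (hrO h), fun _ => 0,
      contMDiffOn_const, fun y hy => ?_⟩
    simp only [image_eq_zero_of_notMem_tsupport hy, zero_mul]

theorem finsum {κ : Type*} {r : κ → M → ℝ} (hr : LocallyFinite fun a => support (r a))
    {φ : κ → S → ℝ} (hφ : ∀ a, SmoothOnSubset I 𝓘(ℝ, ℝ) S (fun x => r a x * φ a x)) :
    SmoothOnSubset I 𝓘(ℝ, ℝ) S (fun x => ∑ᶠ a, r a x * φ a x) := by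
  refine of_locally_eq fun x => ?_
  obtain ⟨V, hV, hfin⟩ := hr x
  obtain ⟨U, hUV, hU, hxU⟩ := mem_nhds_iff.1 hV
  refine ⟨U, hU, hxU, _, sum hfin.toFinset hφ, fun y hy => ?_⟩
  refine (finsum_eq_sum_of_support_subset _ fun a ha => ?_).symm
  rw [Finite.coe_toFinset]
  exact ⟨y, fun h0 => ha (by simp only [h0, zero_mul]), hUV hy⟩

end SmoothOnSubset

end SmoothOnSubset

/-! ### Smoothness of edges and of images of labelled strings -/

namespace LieGroupoid

variable {G H : LieGroupoid.{u}}

section SmoothArrows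

variable {E : Type*} [NormedAddCommGroup E] [NormedSpace ℝ E] {X : Type*} [TopologicalSpace X]
  {M : Type*} [TopologicalSpace M] [ChartedSpace X M] {I : ModelWithCorners ℝ E X} {S : Set M}

theorem smooth_comp {g h : S → G.Arr} (hg : SmoothOnSubset I (𝓡 G.dimArr) S g)
    (hh : SmoothOnSubset I (𝓡 G.dimArr) S h) (e : ∀ x, G.src (g x) = G.tgt (h x)) :
    SmoothOnSubset I (𝓡 G.dimArr) S (fun x => G.comp (g x) (h x)) := by
  simp only [comp_eq_mul (e _)]
  exact G.smooth_mul.comp (g := fun x => ⟨(g x, h x), e x⟩) (hg.prodMk hh)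

theorem smooth_conj {a b g : S → G.Arr} (hb : SmoothOnSubset I (𝓡 G.dimArr) S b)
    (hg : SmoothOnSubset I (𝓡 G.dimArr) S g) (ha : SmoothOnSubset I (𝓡 G.dimArr) S a)
    (ea : ∀ x, G.src (g x) = G.tgt (a x)) (eb : ∀ x, G.tgt (b x) = G.tgt (g x)) :
    SmoothOnSubset I (𝓡 G.dimArr) S (fun x => G.conj (b x) (g x) (a x)) :=
  smooth_comp (hb.contMDiff_comp G.smooth_inv) (smooth_comp hg ha ea) fun x => by
    rw [G.src_inv, tgt_comp (ea x), eb]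

end SmoothArrows

variable {n m : ℕ}

theorem smooth_vertex (j : Fin (n + 1)) : SmoothOnSubset (G.nerveModel n) (𝓡 G.dimObj)
    (G.nerve n) (fun p => p.1.1 j) :=
  SmoothOnSubset.of_contMDiff ((contMDiff_eval_manifold j).comp contMDiff_fst)

theorem smooth_path (j : Fin (n + 1)) : SmoothOnSubset (G.nerveModel n) (𝓡 G.dimArr)
    (G.nerve n) (fun p => path p j) := by
  induction j using Fin.induction with
  | zero =>
    change SmoothOnSubset _ _ _ fun p : G.nerve n => G.unit (p.1.1 0)
    exact (smooth_vertex 0).contMDiff_comp G.smooth_unit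
  | succ j ih =>
    change SmoothOnSubset _ _ _ fun p : G.nerve n => G.comp (p.1.2 j) (path p j.castSucc)
    exact smooth_comp
      (SmoothOnSubset.of_contMDiff ((contMDiff_eval_manifold j).comp contMDiff_snd)) ih
      fun p => (p.2 j).1.trans (src_tgt_path p _).2.symm

theorem smooth_edge (j k : Fin (n + 1)) : SmoothOnSubset (G.nerveModel n) (𝓡 G.dimArr)
    (G.nerve n) (fun p => edge p j k) :=
  smooth_comp (smooth_path k) ((smooth_path j).contMDiff_comp G.smooth_inv)
    fun p => path_inv_composable p j k

theorem LabelledFunctor.smooth_nerveMap {B : Type*} (L : LabelledFunctor G H B)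
    (u : Fin (m + 1) → Fin (n + 1) × B) {T : Set (G.NerveAmbient n)} (hT : T ⊆ G.nerve n)
    (hu : ∀ p ∈ T, ∀ j, p.1 (u j).1 ∈ L.dom (u j).2) :
    SmoothOnSubset (G.nerveModel n) (H.nerveModel m) T
      (fun p => (L.nerveMap ⟨p, hT p.2⟩ u : H.NerveAmbient m)) := by
  refine SmoothOnSubset.prodMk (SmoothOnSubset.pi fun j => ?_) (SmoothOnSubset.pi fun j => ?_)
  · exact (L.smooth_obj (u j).2).comp (g := fun p : T => ⟨p.1.1 (u j).1, hu p p.2 j⟩)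
      ((smooth_vertex (u j).1).restrict hT)
  · refine (L.smooth_arr (u j.castSucc).2 (u j.succ).2).comp
      (g := fun p : T => ⟨edge ⟨p, hT p.2⟩ (u j.castSucc).1 (u j.succ).1, by
        rw [mem_ofPred_eq, src_edge, tgt_edge]
        exact ⟨hu p p.2 _, hu p p.2 _⟩⟩)
      ((smooth_edge _ _).restrict hT)

theorem LabelledFunctor.smooth_cochain_nerveMap {B : Type*} (L : LabelledFunctor G H B)
    (u : Fin (m + 1) → Fin (n + 1) × B) {T : Set (G.NerveAmbient n)} (hT : T ⊆ G.nerve n)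
    (hu : ∀ p ∈ T, ∀ j, p.1 (u j).1 ∈ L.dom (u j).2) (c : H.Cochain m) :
    SmoothOnSubset (G.nerveModel n) 𝓘(ℝ, ℝ) T (fun p => c.1 (L.nerveMap ⟨p, hT p.2⟩ u)) :=
  SmoothOnSubset.comp (g := fun p : T => L.nerveMap ⟨p, hT p.2⟩ u) c.2
    (L.smooth_nerveMap u hT hu)

/-! ### Averages over the labels of the vertices -/

section Average

variable {ι : Type*} (ρ : SmoothPartitionOfUnity ι (𝓡 G.dimObj) G.Obj univ)

/-- The weights of the labels of the vertices of a string. -/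
noncomputable def labelWeight (p : G.nerve n) (j : Fin (n + 1)) (i : ι) : ℝ := ρ i (p.1.1 j)

theorem finite_support_labelWeight (p : G.nerve n) (j : Fin (n + 1)) :
    (support (labelWeight ρ p j)).Finite :=
  ρ.locallyFinite.point_finite (p.1.1 j)

theorem finsum_labelWeight (p : G.nerve n) (j : Fin (n + 1)) :
    ∑ᶠ i, labelWeight ρ p j i = 1 :=
  ρ.sum_eq_one (mem_univ _)

theorem labelWeight_face (p : G.nerve (n + 1)) (i : Fin (n + 2)) :
    labelWeight ρ (face i p) = labelWeight ρ p ∘ i.succAbove := rfl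

/-- Near a given string each vertex admits only finitely many labels of nonzero weight, so only a
finite product of labels contributes. -/
theorem locallyFinite_support_prod (n : ℕ) : LocallyFinite fun a : Fin (n + 1) → ι =>
    support fun p : G.NerveAmbient n => ∏ j, ρ (a j) (p.1 j) := by
  intro p
  choose V hV hfin using fun j => ρ.locallyFinite (p.1 j)
  refine ⟨{q | ∀ j, q.1 j ∈ V j}, ?_, (Set.Finite.pi fun j => hfin j).subset ?_⟩
  · refine Filter.eventually_all.2 fun j => ?_
    exact ((continuous_apply j).comp continuous_fst).continuousAt.preimage_mem_nhds (hV j)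
  · rintro a ⟨q, hq, hqV⟩ j -
    exact ⟨q.1 j, fun h0 => hq (Finset.prod_eq_zero (Finset.mem_univ j) h0), hqV j⟩

/-- The sum over labellings is locally finite, and the weight of a labelling `a` is supported where
every vertex lies in the domain of its label. Hence `φ a` need only be smooth there. -/
theorem smooth_labelAverage {U : ι → Set G.Obj} (hU : ∀ i, IsOpen (U i)) (hρ : ρ.IsSubordinate U)
    {φ : (Fin (n + 1) → ι) → G.nerve n → ℝ}
    (hφ : ∀ a, SmoothOnSubset (G.nerveModel n) 𝓘(ℝ, ℝ) (G.nerve n ∩ {p | ∀ j, p.1 j ∈ U (a j)})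
      (fun p => φ a ⟨p, p.2.1⟩)) :
    SmoothOnSubset (G.nerveModel n) 𝓘(ℝ, ℝ) (G.nerve n)
      (fun p => labelAverage (labelWeight ρ p) fun a => φ a p) := by
  have hc : ∀ j : Fin (n + 1), Continuous fun p : G.NerveAmbient n => p.1 j :=
    fun j => (continuous_apply j).comp continuous_fst
  refine SmoothOnSubset.finsum (locallyFinite_support_prod ρ n) fun a => ?_
  refine SmoothOnSubset.mul_of_tsupport_subset (r := fun p => ∏ j, ρ (a j) (p.1 j)) (φ := φ a)
    (O := {p : G.NerveAmbient n | ∀ j, p.1 j ∈ U (a j)}) ?_ ?_ ?_ (hφ a)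
  · simp only [ofPred_forall]
    exact isOpen_iInter_of_finite fun j => (hU (a j)).preimage (hc j)
  · exact contMDiff_finsetProd fun j _ =>
      (ρ (a j)).contMDiff.comp ((contMDiff_eval_manifold j).comp contMDiff_fst)
  · intro p hp j
    have hcl : IsClosed {p : G.NerveAmbient n | p.1 j ∈ tsupport (ρ (a j))} :=
      (isClosed_tsupport _).preimage (hc j)
    refine hρ (a j) (closure_minimal (fun q hq => ?_) hcl hp)
    refine subset_tsupport _ fun h0 => mem_support.1 hq ?_
    exact Finset.prod_eq_zero (Finset.mem_univ j) h0

variable {B : Type*} (L : LabelledFunctor G H B)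

/-- Pullback of cochains along a labelled functor, averaged over the labels. -/
noncomputable def averagePullback (l : ι → B) (hl : ρ.IsSubordinate fun i => L.dom (l i)) (n : ℕ) :
    H.Cochain n →ₗ[ℝ] G.Cochain n where
  toFun c := ⟨fun p => labelAverage (labelWeight ρ p) fun a => c.1 (L.mapString p (l ∘ a)),
    smooth_labelAverage ρ (fun _ => L.isOpen_dom _) hl fun a => 
      L.smooth_cochain_nerveMap (fun j => (j, l (a j))) inter_subset_left (fun _ hp => hp.2) c⟩
  map_add' _ _ := Subtype.ext <| funext fun p =>
    labelAverage_add (finite_support_labelWeight ρ p) _ _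
  map_smul' _ _ := Subtype.ext <| funext fun p =>
    labelAverage_mul_left (finite_support_labelWeight ρ p) _ _

/-- The image of the `i`-th face does not involve the label of vertex `i`, so that label can be
inserted into the average by `labelAverage_succAbove`. The identity then holds labelling by
labelling. -/
theorem differential_averagePullback (l : ι → B) (hl : ρ.IsSubordinate fun i => L.dom (l i))
    (n : ℕ) (c : H.Cochain n) : G.differential n (averagePullback ρ L l hl n c) =
      averagePullback ρ L l hl (n + 1) (H.differential n c) := by
  refine Subtype.ext (funext fun p => ?_)
  have hfin := finite_support_labelWeight ρ p
  have e : (averagePullback ρ L l hl (n + 1) (H.differential n c)).1 p =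
      labelAverage (labelWeight ρ p) fun a => ∑ i : Fin (n + 2),
        (-1 : ℝ) ^ (i : ℕ) * c.1 (face i (L.mapString p (l ∘ a))) := by
    simp only [← differential_apply]
    rfl
  rw [e, differential_apply, labelAverage_sum hfin]
  refine Finset.sum_congr rfl fun i _ => ?_
  rw [labelAverage_mul_left hfin]
  congr 1
  change labelAverage (labelWeight ρ (face i p)) _ = _
  rw [labelWeight_face, ← labelAverage_succAbove hfin i (finsum_labelWeight ρ p i)]
  congr 1
  funext a
  rw [LabelledFunctor.mapString, LabelledFunctor.mapString, LabelledFunctor.nerveMap_face,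
    LabelledFunctor.face_nerveMap]
  rfl

/-- The average of the prism operator between two labellings of the vertices. -/
noncomputable def averagePrism (l l' : ι → B)
    (hl : ρ.IsSubordinate fun i => L.dom (l i) ∩ L.dom (l' i)) (n : ℕ) :
    H.Cochain (n + 1) →ₗ[ℝ] G.Cochain n where
  toFun c := ⟨fun p => labelAverage (labelWeight ρ p) fun a =>
      tuplePrism (fun u => c.1 (L.nerveMap p u)) (fun j => (j, l (a j))) (fun j => (j, l' (a j))),
    smooth_labelAverage ρ (fun i => (L.isOpen_dom _).inter (L.isOpen_dom _)) hl fun a =>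
      SmoothOnSubset.sum _ fun i => SmoothOnSubset.const_mul _ <|
        L.smooth_cochain_nerveMap _ inter_subset_left (fun p hp j => by
          rw [prismTuple]
          split_ifs
          · exact (hp.2 _).1
          · exact (hp.2 _).2) c⟩
  map_add' _ _ := Subtype.ext <| funext fun p =>
    (congrArg _ (funext fun _ => tuplePrism_add _ _ _ _)).trans
      (labelAverage_add (finite_support_labelWeight ρ p) _ _)
  map_smul' _ _ := Subtype.ext <| funext fun p =>
    (congrArg _ (funext fun _ => tuplePrism_const_mul _ _ _ _)).trans
      (labelAverage_mul_left (finite_support_labelWeight ρ p) _ _)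

theorem averagePrism_differential_apply (l l' : ι → B)
    (hl : ρ.IsSubordinate fun i => L.dom (l i) ∩ L.dom (l' i)) (n : ℕ) (c : H.Cochain n)
    (p : G.nerve n) : (averagePrism ρ L l l' hl n (H.differential n c)).1 p =
      labelAverage (labelWeight ρ p) fun a =>
        tuplePrism (tupleDifferential fun u => c.1 (L.nerveMap p u))
          (fun j => (j, l (a j))) (fun j => (j, l' (a j))) := by
  have e : (fun u : Fin (n + 2) → Fin (n + 1) × B => (H.differential n c).1 (L.nerveMap p u)) =
      tupleDifferential (fun u => c.1 (L.nerveMap p u)) := funext fun u => by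
    simp only [differential_apply, LabelledFunctor.face_nerveMap]
    rfl
  rw [← e]
  rfl

theorem differential_averagePrism_apply (l l' : ι → B)
    (hl : ρ.IsSubordinate fun i => L.dom (l i) ∩ L.dom (l' i)) (n : ℕ) (c : H.Cochain (n + 1))
    (p : G.nerve (n + 1)) : (G.differential n (averagePrism ρ L l l' hl n c)).1 p =
      labelAverage (labelWeight ρ p) fun a => ∑ i : Fin (n + 2), (-1 : ℝ) ^ (i : ℕ) *
        tuplePrism (fun u => c.1 (L.nerveMap p u))
          ((fun j => (j, l (a j))) ∘ i.succAbove) ((fun j => (j, l' (a j))) ∘ i.succAbove) := by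
  have hfin := finite_support_labelWeight ρ p
  rw [differential_apply, labelAverage_sum hfin]
  refine Finset.sum_congr rfl fun i _ => ?_
  rw [labelAverage_mul_left hfin]
  congr 1
  change labelAverage (labelWeight ρ (face i p)) _ = _
  rw [labelWeight_face, ← labelAverage_succAbove hfin i (finsum_labelWeight ρ p i)]
  congr 1
  funext a
  refine Finset.sum_congr rfl fun k _ => ?_
  dsimp only
  rw [LabelledFunctor.nerveMap_face]
  -- Passing to the face renumbers the vertices in both tuples alike, so it commutes with forming
  -- `prismTuple`.
  refine congrArg _ (congrArg c.1 (congrArg _ (funext fun j => ?_)))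
  simp only [prismTuple]
  split_ifs <;> rfl

/-- The average of `tuplePrism_homotopy`. The second term is left as an average because only for
positive `n` is it the differential of a cochain; for `n = 0` its prisms are empty sums. -/
theorem averagePrism_homotopy_apply (l l' : ι → B)
    (hl : ρ.IsSubordinate fun i => L.dom (l i) ∩ L.dom (l' i))
    (h : ρ.IsSubordinate fun i => L.dom (l i))
    (h' : ρ.IsSubordinate fun i => L.dom (l' i)) (n : ℕ) (c : H.Cochain n) (p : G.nerve n) :
    (averagePrism ρ L l l' hl n (H.differential n c)).1 p +
      (labelAverage (labelWeight ρ p) fun a => ∑ i : Fin (n + 1), (-1 : ℝ) ^ (i : ℕ) *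
        tuplePrism (fun u => c.1 (L.nerveMap p u))
          ((fun j => (j, l (a j))) ∘ i.succAbove) ((fun j => (j, l' (a j))) ∘ i.succAbove)) =
    (averagePullback ρ L l' h' n c).1 p - (averagePullback ρ L l h n c).1 p := by
  have hfin := finite_support_labelWeight ρ p
  rw [averagePrism_differential_apply, ← labelAverage_add hfin]
  simp only [tuplePrism_homotopy]
  rw [eq_sub_iff_add_eq]
  refine (labelAverage_add hfin _ _).symm.trans ?_
  congr 1
  funext a
  exact sub_add_cancel _ _

/-- Averages over two labellings of the vertices by the same partition of unity are homotopic. -/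
theorem averagePrism_homotopy_succ (l l' : ι → B)
    (hl : ρ.IsSubordinate fun i => L.dom (l i) ∩ L.dom (l' i))
    (h : ρ.IsSubordinate fun i => L.dom (l i))
    (h' : ρ.IsSubordinate fun i => L.dom (l' i)) (n : ℕ) (c : H.Cochain (n + 1)) :
    averagePrism ρ L l l' hl (n + 1) (H.differential (n + 1) c) +
      G.differential n (averagePrism ρ L l l' hl n c) + averagePullback ρ L l h (n + 1) c =
    averagePullback ρ L l' h' (n + 1) c := by
  refine Subtype.ext (funext fun p => ?_)
  have e := averagePrism_homotopy_apply ρ L l l' hl h h' (n + 1) c p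
  rw [← differential_averagePrism_apply ρ L l l' hl n c p] at e
  exact (add_eq_of_eq_sub e)

theorem averagePrism_homotopy_zero (l l' : ι → B)
    (hl : ρ.IsSubordinate fun i => L.dom (l i) ∩ L.dom (l' i))
    (h : ρ.IsSubordinate fun i => L.dom (l i))
    (h' : ρ.IsSubordinate fun i => L.dom (l' i)) (c : H.Cochain 0) :
    averagePrism ρ L l l' hl 0 (H.differential 0 c) + averagePullback ρ L l h 0 c =
    averagePullback ρ L l' h' 0 c := by
  refine Subtype.ext (funext fun p => ?_)
  have e := averagePrism_homotopy_apply ρ L l l' hl h h' 0 c p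
  simp only [tuplePrism, Finset.univ_eq_empty, Finset.sum_empty, mul_zero, Finset.sum_const_zero,
    labelAverage, finsum_zero, add_zero] at e
  exact (add_eq_of_eq_sub e)

end Average

end LieGroupoid

/-! ### Smooth local sections -/

section RightInverse

variable {E F : Type*} [NormedAddCommGroup E] [NormedSpace ℝ E]
  [NormedAddCommGroup F] [NormedSpace ℝ F]

/-- The inverse function theorem at `a` gives a local inverse; it is smooth at each point whose
preimage has invertible derivative, and the target is shrunk to such points. -/
theorem exists_smooth_local_inverse [FiniteDimensional ℝ E] {f : E → E} {V : Set E} {a : E}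
    (hV : IsOpen V) (ha : a ∈ V) (hf : ContDiffOn ℝ ∞ f V)
    (hfa : HasFDerivAt f (ContinuousLinearMap.id ℝ E) a) :
    ∃ (W : Set E) (s : E → E), IsOpen W ∧ f a ∈ W ∧ ContDiffOn ℝ ∞ s W ∧
      ∀ y ∈ W, s y ∈ V ∧ f (s y) = y := by
  have : CompleteSpace E := FiniteDimensional.complete ℝ E
  have hfa' : HasFDerivAt f ((ContinuousLinearEquiv.refl ℝ E : E ≃L[ℝ] E) : E →L[ℝ] E) a := hfa
  have hca := hf.contDiffAt (hV.mem_nhds ha)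
  let e := hca.toOpenPartialHomeomorph f hfa' (by simp)
  have he : ⇑e = f := hca.toOpenPartialHomeomorph_coe hfa' (by simp)
  have hae : a ∈ e.source := hca.mem_toOpenPartialHomeomorph_source hfa' (by simp)
  -- Invertible operators form an open set and the derivative is continuous on `V`, so invertibility
  -- persists near `a`.
  have hA : IsOpen (V ∩ fderiv ℝ f ⁻¹' range ((↑) : (E ≃L[ℝ] E) → E →L[ℝ] E)) :=
    (hf.continuousOn_fderiv_of_isOpen hV (by simp)).isOpen_inter_preimage hV
      ContinuousLinearEquiv.isOpen
  have hfae : f a ∈ e.target := he ▸ e.map_source hae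
  have hsymm : e.symm (f a) = a := he ▸ e.left_inv hae
  refine ⟨_, e.symm, e.isOpen_inter_preimage_symm hA, ⟨hfae, ?_⟩, ?_, ?_⟩
  · rw [mem_preimage, hsymm]
    exact ⟨ha, _, hfa'.fderiv.symm⟩
  · rintro y ⟨hy, hyV, f', hf'⟩
    have hcy := hf.contDiffAt (hV.mem_nhds hyV)
    refine (e.contDiffAt_symm (f₀' := f') hy ?_ ?_).contDiffWithinAt
    · rw [he, hf']
      exact (hcy.differentiableAt (by simp)).hasFDerivAt
    · rw [he]
      exact hcy
  · rintro y ⟨hy, hyV, -⟩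
    exact ⟨hyV, by rw [← he, e.right_inv hy]⟩

/-- Restricting `f` to the affine slice `a + R w`, with `R` a linear right inverse of `f'`, gives a
map with derivative the identity at 0; its local inverse, composed with the slice, is the section.
-/
theorem exists_smooth_right_inverse [FiniteDimensional ℝ F] {f : E → F} {f' : E →L[ℝ] F}
    {V : Set E} {a : E} (hV : IsOpen V) (ha : a ∈ V) (hf : ContDiffOn ℝ ∞ f V)
    (hfa : HasFDerivAt f f' a)
    (hf' : Surjective f') :
    ∃ (W : Set F) (s : F → E), IsOpen W ∧ f a ∈ W ∧ ContDiffOn ℝ ∞ s W ∧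
      ∀ y ∈ W, s y ∈ V ∧ f (s y) = y := by
  obtain ⟨R, hR⟩ := f'.toLinearMap.exists_rightInverse_of_surjective (LinearMap.range_eq_top.2 hf')
  let j : F → E := fun w => a + LinearMap.toContinuousLinearMap R w
  have hj : ContDiff ℝ ∞ j := contDiff_const.add (LinearMap.toContinuousLinearMap R).contDiff
  have hj0 : j 0 = a := by simp [j]
  have hjd : HasFDerivAt j (LinearMap.toContinuousLinearMap R) 0 :=
    (LinearMap.toContinuousLinearMap R).hasFDerivAt.const_add a
  have hd : HasFDerivAt (f ∘ j) (ContinuousLinearMap.id ℝ F) 0 := by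
    rw [← hj0] at hfa
    refine (hfa.comp 0 hjd).congr_fderiv (ContinuousLinearMap.ext fun w => ?_)
    exact LinearMap.congr_fun hR w
  obtain ⟨W, s, hW, h0, hs, h⟩ := exists_smooth_local_inverse (V := j ⁻¹' V) (a := 0)
    (hV.preimage hj.continuous) (by rwa [mem_preimage, hj0])
    (hf.comp hj.contDiffOn fun _ hx => hx) hd
  refine ⟨W, j ∘ s, hW, by rwa [comp_apply, hj0] at h0, hj.comp_contDiffOn hs, h⟩

end RightInverse

section Charts

variable {E : Type*} [NormedAddCommGroup E] [NormedSpace ℝ E] {H : Type*} [TopologicalSpace H]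
  {E' : Type*} [NormedAddCommGroup E'] [NormedSpace ℝ E'] {H' : Type*} [TopologicalSpace H']
  {M : Type*} [TopologicalSpace M] [ChartedSpace H M]
  {N : Type*} [TopologicalSpace N] [ChartedSpace H' N]
  {I : ModelWithCorners ℝ E H} {J : ModelWithCorners ℝ E' H'}

theorem ContMDiff.hasFDerivAt_extChartAt [I.Boundaryless] {f : M → N} (hf : ContMDiff I J ∞ f)
    (x : M) : HasFDerivAt (fun v => extChartAt J (f x) (f ((extChartAt I x).symm v)))
      (mfderiv I J f x : E →L[ℝ] E') (extChartAt I x x) := by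
  have h := ((hf x).mdifferentiableAt (by simp)).hasMFDerivAt.2
  rw [I.range_eq_univ] at h
  exact h.hasFDerivAt_of_univ

theorem ContMDiff.contDiffOn_extChartAt [IsManifold I ∞ M] [IsManifold J ∞ N] {f : M → N}
    (hf : ContMDiff I J ∞ f) (x : M) (y : N) :
    ContDiffOn ℝ ∞ (fun v => extChartAt J y (f ((extChartAt I x).symm v)))
      ((extChartAt I x).target ∩ (extChartAt I x).symm ⁻¹' (f ⁻¹' (extChartAt J y).source)) := by
  rw [← contMDiffOn_iff_contDiffOn]
  refine (contMDiffOn_extChartAt (x := y)).comp (t := (chartAt H' y).source)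
    (hf.comp_contMDiffOn ((contMDiffOn_extChartAt_symm x).mono inter_subset_left)) ?_
  rintro v ⟨-, hv⟩
  rwa [mem_preimage, mem_preimage, extChartAt_source] at hv

end Charts

namespace LieGroupoid

variable {G H : LieGroupoid.{u}}

/-- In charts, the fibre product is the zero set of `src g - f x`. The map `Θ = (src g - f x, tgt
g)` is a submersion at the chosen point, so it has a local right inverse, whose restriction to `{0}
× G.Obj` is the desired section. No manifold structure on the fibre product is needed. -/
theorem SmoothlyEssentiallySurjective.exists_local_section {d : ℕ} {N : Type u} [TopologicalSpace N]
    [ChartedSpace (EuclideanSpace ℝ (Fin d)) N] [IsManifold (𝓡 d) ∞ N] {f : N → G.Obj}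
    (hf : ContMDiff (𝓡 d) (𝓡 G.dimObj) ∞ f) (h : G.SmoothlyEssentiallySurjective (d := d) f)
    (y₀ : G.Obj) :
    ∃ (U : Set G.Obj) (g : G.Obj → G.Arr) (x : G.Obj → N), IsOpen U ∧ y₀ ∈ U ∧
      ContMDiffOn (𝓡 G.dimObj) (𝓡 G.dimArr) ∞ g U ∧ ContMDiffOn (𝓡 G.dimObj) (𝓡 d) ∞ x U ∧
      ∀ y ∈ U, G.src (g y) = f (x y) ∧ G.tgt (g y) = y := by
  obtain ⟨g₀, x₀, hgx, rfl⟩ := h.1 y₀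
  have hs := G.smooth_src.hasFDerivAt_extChartAt g₀
  have ht := G.smooth_tgt.hasFDerivAt_extChartAt g₀
  have hfd := hf.hasFDerivAt_extChartAt x₀
  rw [← hgx] at hfd
  have hss := G.submersion_src g₀
  have hst := h.2 g₀ x₀ hgx
  set Ds : EuclideanSpace ℝ (Fin G.dimArr) →L[ℝ] EuclideanSpace ℝ (Fin G.dimObj) :=
    mfderiv (𝓡 G.dimArr) (𝓡 G.dimObj) G.src g₀ with hDs
  set Dt : EuclideanSpace ℝ (Fin G.dimArr) →L[ℝ] EuclideanSpace ℝ (Fin G.dimObj) :=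
    mfderiv (𝓡 G.dimArr) (𝓡 G.dimObj) G.tgt g₀ with hDt
  set Df : EuclideanSpace ℝ (Fin d) →L[ℝ] EuclideanSpace ℝ (Fin G.dimObj) :=
    mfderiv (𝓡 d) (𝓡 G.dimObj) f x₀ with hDf
  have hss' : ∀ a, ∃ u : EuclideanSpace ℝ (Fin G.dimArr), Ds u = a := hss
  have hst' : ∀ w, ∃ u v, Ds u = Df v ∧ Dt u = w := by
    intro w
    obtain ⟨u, v, huv, hu⟩ := hst w
    -- The hypothesis is an equation in the tangent bundle; its fibre components are vectors of one
    -- Euclidean space.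
    exact ⟨u, v, eq_of_heq (Bundle.TotalSpace.mk.inj huv).2, hu⟩
  let φ := extChartAt (𝓡 G.dimArr) g₀
  let χ := extChartAt (𝓡 d) x₀
  let ψ := extChartAt (𝓡 G.dimObj) (G.tgt g₀)
  let ψ' := extChartAt (𝓡 G.dimObj) (G.src g₀)
  let V₁ := φ.target ∩ φ.symm ⁻¹' (G.src ⁻¹' ψ'.source)
  let V₂ := φ.target ∩ φ.symm ⁻¹' (G.tgt ⁻¹' ψ.source)
  let V₃ := χ.target ∩ χ.symm ⁻¹' (f ⁻¹' ψ'.source)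
  have hV₁ : IsOpen V₁ := (continuousOn_extChartAt_symm g₀).isOpen_inter_preimage
    (isOpen_extChartAt_target g₀) ((isOpen_extChartAt_source _).preimage G.smooth_src.continuous)
  have hV₂ : IsOpen V₂ := (continuousOn_extChartAt_symm g₀).isOpen_inter_preimage
    (isOpen_extChartAt_target g₀) ((isOpen_extChartAt_source _).preimage G.smooth_tgt.continuous)
  have hV₃ : IsOpen V₃ := (continuousOn_extChartAt_symm x₀).isOpen_inter_preimage
    (isOpen_extChartAt_target x₀) ((isOpen_extChartAt_source _).preimage hf.continuous)
  have hs' : ContDiffOn ℝ ∞ (fun u => ψ' (G.src (φ.symm u))) V₁ :=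
    G.smooth_src.contDiffOn_extChartAt g₀ (G.src g₀)
  have ht' : ContDiffOn ℝ ∞ (fun u => ψ (G.tgt (φ.symm u))) V₂ :=
    G.smooth_tgt.contDiffOn_extChartAt g₀ (G.tgt g₀)
  have hf' : ContDiffOn ℝ ∞ (fun v => ψ' (f (χ.symm v))) V₃ :=
    hf.contDiffOn_extChartAt x₀ (G.src g₀)
  let V : Set (EuclideanSpace ℝ (Fin G.dimArr) × EuclideanSpace ℝ (Fin d)) := (V₁ ∩ V₂) ×ˢ V₃
  let Θ : EuclideanSpace ℝ (Fin G.dimArr) × EuclideanSpace ℝ (Fin d) →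
      EuclideanSpace ℝ (Fin G.dimObj) × EuclideanSpace ℝ (Fin G.dimObj) := fun z =>
    (ψ' (G.src (φ.symm z.1)) - ψ' (f (χ.symm z.2)), ψ (G.tgt (φ.symm z.1)))
  have hφ₀ : φ.symm (φ g₀) = g₀ := extChartAt_to_inv g₀
  have hχ₀ : χ.symm (χ x₀) = x₀ := extChartAt_to_inv x₀
  have hV₀ : (φ g₀, χ x₀) ∈ V := by
    refine ⟨⟨⟨mem_extChartAt_target g₀, ?_⟩, mem_extChartAt_target g₀, ?_⟩,
      mem_extChartAt_target x₀, ?_⟩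
    · rw [mem_preimage, mem_preimage, hφ₀]
      exact mem_extChartAt_source _
    · rw [mem_preimage, mem_preimage, hφ₀]
      exact mem_extChartAt_source _
    · rw [mem_preimage, mem_preimage, hχ₀, ← hgx]
      exact mem_extChartAt_source _
  have hΘ : ContDiffOn ℝ ∞ Θ V :=
    ((hs'.comp contDiff_fst.contDiffOn fun _ hz => hz.1.1).sub
      (hf'.comp contDiff_snd.contDiffOn fun _ hz => hz.2)).prodMk
      (ht'.comp contDiff_fst.contDiffOn fun _ hz => hz.1.2)
  have hΘ' : HasFDerivAt Θ
      ((Ds.comp (ContinuousLinearMap.fst ℝ _ _) - Df.comp (ContinuousLinearMap.snd ℝ _ _)).prod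
        (Dt.comp (ContinuousLinearMap.fst ℝ _ _))) (φ g₀, χ x₀) :=
    ((HasFDerivAt.comp (φ g₀, χ x₀) (f := Prod.fst) hs hasFDerivAt_fst).sub
      (HasFDerivAt.comp (φ g₀, χ x₀) (f := Prod.snd) hfd hasFDerivAt_snd)).prodMk
      (HasFDerivAt.comp (φ g₀, χ x₀) (f := Prod.fst) ht hasFDerivAt_fst)
  obtain ⟨W, s, hW, hW₀, hsW, hs⟩ := exists_smooth_right_inverse
    ((hV₁.inter hV₂).prod hV₃) hV₀ hΘ hΘ' (by
      rintro ⟨a, b⟩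
      -- Since `src` is a submersion, `u'` realizes the first component; a vector `(u, v)` tangent
      -- to the fibre product then corrects the second without changing the first.
      obtain ⟨u', hu'⟩ := hss' a
      obtain ⟨u, v, huv, hu⟩ := hst' (b - Dt u')
      refine ⟨(u + u', v), Prod.ext ?_ ?_⟩
      · change Ds (u + u') - Df v = a
        rw [map_add, huv, add_sub_cancel_left, hu']
      · change Dt (u + u') = b
        rw [map_add, hu, sub_add_cancel])
  have hΘ₀ : Θ (φ g₀, χ x₀) = (0, ψ (G.tgt g₀)) := by
    simp only [Θ, hφ₀, hχ₀, hgx, sub_self]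
  rw [hΘ₀] at hW₀
  have hψ : ContMDiffOn (𝓡 G.dimObj) 𝓘(ℝ, EuclideanSpace ℝ (Fin G.dimObj)) ∞ ψ ψ.source := by
    have := contMDiffOn_extChartAt (I := 𝓡 G.dimObj) (n := ∞) (x := G.tgt g₀)
    rwa [← extChartAt_source (𝓡 G.dimObj)] at this
  let U : Set G.Obj := ψ.source ∩ ψ ⁻¹' ((fun z => (0, z)) ⁻¹' W)
  have hU : IsOpen U := hψ.continuousOn.isOpen_inter_preimage (isOpen_extChartAt_source _)
    (hW.preimage (by fun_prop))
  have hσ : ContMDiffOn (𝓡 G.dimObj)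
      𝓘(ℝ, EuclideanSpace ℝ (Fin G.dimArr) × EuclideanSpace ℝ (Fin d)) ∞
      (fun y => s (0, ψ y)) U := by
    refine (contMDiffOn_iff_contDiffOn.2 hsW).comp
      (ContMDiff.comp_contMDiffOn (g := fun z => ((0 : EuclideanSpace ℝ (Fin G.dimObj)), z)) ?_
        (hψ.mono inter_subset_left)) fun y hy => hy.2
    exact contMDiff_iff_contDiff.2 (by fun_prop)
  refine ⟨U, fun y => φ.symm (s (0, ψ y)).1, fun y => χ.symm (s (0, ψ y)).2, hU,
    ⟨mem_extChartAt_source _, hW₀⟩, ?_, ?_, ?_⟩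
  · refine (contMDiffOn_extChartAt_symm g₀).comp (ContMDiff.comp_contMDiffOn (g := Prod.fst)
      (contMDiff_iff_contDiff.2 contDiff_fst) hσ) fun y hy => (hs _ hy.2).1.1.1.1
  · refine (contMDiffOn_extChartAt_symm x₀).comp (ContMDiff.comp_contMDiffOn (g := Prod.snd)
      (contMDiff_iff_contDiff.2 contDiff_snd) hσ) fun y hy => (hs _ hy.2).1.2.1
  · intro y hy
    obtain ⟨hsV, hsy⟩ := hs _ hy.2
    have h1 := congrArg Prod.fst hsy
    have h2 := congrArg Prod.snd hsy
    exact ⟨ψ'.injOn hsV.1.1.2 hsV.2.2 (sub_eq_zero.1 h1), ψ.injOn hsV.1.2.2 hy.1 h2⟩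

end LieGroupoid

/-- The pullback of a smooth partition of unity along a smooth map. -/
noncomputable def SmoothPartitionOfUnity.comap {E : Type*} [NormedAddCommGroup E] [NormedSpace ℝ E]
    {X : Type*} [TopologicalSpace X] {E' : Type*} [NormedAddCommGroup E'] [NormedSpace ℝ E']
    {X' : Type*}
    [TopologicalSpace X'] {M : Type*} [TopologicalSpace M] [ChartedSpace X M]
    {N : Type*} [TopologicalSpace N] [ChartedSpace X' N] {I : ModelWithCorners ℝ E X}
    {J : ModelWithCorners ℝ E' X'} {ι : Type*} (ρ : SmoothPartitionOfUnity ι J N univ)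
    {f : M → N} (hf : ContMDiff I J ∞ f) : SmoothPartitionOfUnity ι I M univ where
  toFun i := (ρ i).comp ⟨f, hf⟩
  locallyFinite' := ρ.locallyFinite.preimage_continuous hf.continuous
  nonneg' i x := ρ.nonneg i (f x)
  sum_eq_one' x _ := ρ.sum_eq_one (mem_univ (f x))
  sum_le_one' x := ρ.sum_le_one (f x)

namespace LieGroupoid

variable {G H : LieGroupoid.{u}} {ι : Type*}

/-! ### Examples of labelled functors -/

section Functors

/-- A homomorphism, as a labelled functor that does not depend on the label. -/
def Hom.toLabelledFunctor (F : Hom H G) : LabelledFunctor H G Unit where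
  obj _ := F.obj
  arr _ _ := F.arr
  dom _ := univ
  src_arr _ _ := F.src_arr
  tgt_arr _ _ := F.tgt_arr
  map_comp _ _ _ _ _ := F.map_comp
  isOpen_dom _ := isOpen_univ
  smooth_obj _ := SmoothOnSubset.of_contMDiff F.smooth_obj
  smooth_arr _ _ := SmoothOnSubset.of_contMDiff F.smooth_arr

/-- Local lifts of the objects of `G` along the object map of `F : H → G`, up to an arrow of `G`:
for each label `i` and each object `y` an object `lift i y` of `H` and an arrow
`arrow i y : F (lift i y) → y`, smooth on the open set `dom i`. -/
structure LocalLifts (F : Hom H G) (ι : Type*) where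
  /-- the arrow from the image of the lift -/
  arrow : ι → G.Obj → G.Arr
  /-- the lift -/
  lift : ι → G.Obj → H.Obj
  /-- the domain of smoothness of a label -/
  dom : ι → Set G.Obj
  src_arrow : ∀ i y, G.src (arrow i y) = F.obj (lift i y)
  tgt_arrow : ∀ i y, G.tgt (arrow i y) = y
  isOpen_dom : ∀ i, IsOpen (dom i)
  smooth_arrow : ∀ i, ContMDiffOn (𝓡 G.dimObj) (𝓡 G.dimArr) ∞ (arrow i) (dom i)
  smooth_lift : ∀ i, ContMDiffOn (𝓡 G.dimObj) (𝓡 H.dimObj) ∞ (lift i) (dom i)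

/-- The labels are the objects of `G`, with one local section around each. Outside its domain a
section is continued by arbitrary pointwise choices, so that functoriality holds everywhere and only
smoothness is local. -/
theorem SmoothlyEssentiallySurjective.exists_localLifts {F : Hom H G}
    (h : G.SmoothlyEssentiallySurjective (d := H.dimObj) F.obj) :
    ∃ s : LocalLifts F G.Obj, ∀ y, y ∈ s.dom y := by
  classical
  choose g₀ x₀ hs₀ ht₀ using h.1
  choose U g x hU hyU hg hx hgx using h.exists_local_section F.smooth_obj
  refine ⟨{
    arrow := fun i => (U i).piecewise (g i) g₀
    lift := fun i => (U i).piecewise (x i) x₀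
    dom := U
    src_arrow := fun i y => ?_
    tgt_arrow := fun i y => ?_
    isOpen_dom := hU
    smooth_arrow := fun i => (hg i).congr fun y hy => piecewise_eq_of_mem _ _ _ hy
    smooth_lift := fun i => (hx i).congr fun y hy => piecewise_eq_of_mem _ _ _ hy }, hyU⟩
  · by_cases hy : y ∈ U i
    · simp only [piecewise_eq_of_mem _ _ _ hy, (hgx i y hy).1]
    · simp only [piecewise_eq_of_notMem _ _ _ hy, hs₀]
  · by_cases hy : y ∈ U i
    · simp only [piecewise_eq_of_mem _ _ _ hy, (hgx i y hy).2]
    · simp only [piecewise_eq_of_notMem _ _ _ hy, ht₀]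

/-- Conjugation with a family of arrows `t b y : src (t b y) → y`, as a labelled
functor. -/
noncomputable def conjFunctor {B : Type*} (t : B → G.Obj → G.Arr) (dom : B → Set G.Obj)
    (ht : ∀ b y, G.tgt (t b y) = y) (hd : ∀ b, IsOpen (dom b))
    (hs : ∀ b, SmoothOnSubset (𝓡 G.dimObj) (𝓡 G.dimArr) (dom b) (fun y => t b y)) :
    LabelledFunctor G G B where
  obj b y := G.src (t b y)
  arr a b g := G.conj (t b (G.tgt g)) g (t a (G.src g))
  dom := dom
  src_arr a b g := src_conj (ht _ _).symm (ht _ _)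
  tgt_arr a b g := tgt_conj (ht _ _).symm (ht _ _)
  map_comp a b c g h e := by
    rw [src_comp e, tgt_comp e, e, conj_comp_conj (ht _ _).symm (ht _ _)
      (e.trans (ht _ _).symm) (ht _ _)]
  isOpen_dom := hd
  smooth_obj b := (hs b).contMDiff_comp G.smooth_src
  smooth_arr a b := smooth_conj
    ((hs b).comp (g := fun g : {g | G.src g ∈ dom a ∧ G.tgt g ∈ dom b} => ⟨G.tgt g, g.2.2⟩)
      (SmoothOnSubset.of_contMDiff G.smooth_tgt))
    (SmoothOnSubset.of_contMDiff contMDiff_id)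
    ((hs a).comp (g := fun g : {g | G.src g ∈ dom a ∧ G.tgt g ∈ dom b} => ⟨G.src g, g.2.1⟩)
      (SmoothOnSubset.of_contMDiff G.smooth_src))
    (fun _ => (ht _ _).symm) (fun _ => ht _ _)

/-- The extension of a family of arrows by the units. -/
def arrowOrUnit (t : ι → G.Obj → G.Arr) (b : Option ι) (y : G.Obj) : G.Arr :=
  b.elim (G.unit y) fun i => t i y

/-- Conjugation with a family of arrows `t i y : src (t i y) → y`, as a labelled functor that is the
identity for the additional label `none`. -/
noncomputable def optionConjFunctor (t : ι → G.Obj → G.Arr) (dom : ι → Set G.Obj)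
    (ht : ∀ i y, G.tgt (t i y) = y) (hd : ∀ i, IsOpen (dom i))
    (hs : ∀ i, SmoothOnSubset (𝓡 G.dimObj) (𝓡 G.dimArr) (dom i) (fun y => t i y)) :
    LabelledFunctor G G (Option ι) :=
  conjFunctor (arrowOrUnit t) (fun b => b.elim univ dom)
    (fun b y => by cases b; exacts [G.tgt_unit y, ht _ y])
    (fun b => by cases b; exacts [isOpen_univ, hd _])
    (fun b => by cases b; exacts [SmoothOnSubset.of_contMDiff G.smooth_unit, hs _])

theorem mapString_optionConjFunctor_none {t : ι → G.Obj → G.Arr} {dom : ι → Set G.Obj}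
    {ht : ∀ i y, G.tgt (t i y) = y} {hd : ∀ i, IsOpen (dom i)}
    {hs : ∀ i, SmoothOnSubset (𝓡 G.dimObj) (𝓡 G.dimArr) (dom i) (fun y => t i y)} {n : ℕ}
    (p : G.nerve n) : (optionConjFunctor t dom ht hd hs).mapString p (fun _ => none) = p :=
  nerve_ext (fun _ => G.src_unit _) fun j => by
    rw [LabelledFunctor.mapString_arr]
    exact conj_unit rfl rfl

theorem averagePullback_optionConjFunctor_none
    (ρ : SmoothPartitionOfUnity ι (𝓡 G.dimObj) G.Obj univ)
    {t : ι → G.Obj → G.Arr} {dom : ι → Set G.Obj}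
    {ht : ∀ i y, G.tgt (t i y) = y} {hd : ∀ i, IsOpen (dom i)}
    {hs : ∀ i, SmoothOnSubset (𝓡 G.dimObj) (𝓡 G.dimArr) (dom i) (fun y => t i y)}
    (hl : ρ.IsSubordinate fun _ => (optionConjFunctor t dom ht hd hs).dom none) (n : ℕ)
    (c : G.Cochain n) :
    averagePullback ρ (optionConjFunctor t dom ht hd hs) (fun _ => none) hl n c = c :=
  Subtype.ext <| funext fun p => by
    refine Eq.trans ?_ (labelAverage_const (finite_support_labelWeight ρ p)
      (finsum_labelWeight ρ p) (c.1 p))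
    change labelAverage (labelWeight ρ p)
      (fun _ => c.1 ((optionConjFunctor t dom ht hd hs).mapString p fun _ => none)) = _
    rw [mapString_optionConjFunctor_none]

end Functors

/-! ### Labelled functors attached to a weak equivalence -/

section WeakEquivalence

variable {F : Hom H G} {K : G.pullbackArr F.obj → H.Arr}

theorem Hom.arr_ext (hK : LeftInverse K F.toPullback) {h h' : H.Arr} (ht : H.tgt h = H.tgt h')
    (ha : F.arr h = F.arr h') (hs : H.src h = H.src h') : h = h' :=
  hK.injective (Subtype.ext (Prod.ext ht (Prod.ext ha hs)))

theorem Hom.inverse_spec (hK : RightInverse K F.toPullback) (q : G.pullbackArr F.obj) :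
    H.tgt (K q) = q.1.1 ∧ F.arr (K q) = q.1.2.1 ∧ H.src (K q) = q.1.2.2 := by
  have h := congrArg Subtype.val (hK q)
  exact ⟨congrArg Prod.fst h, congrArg (fun z => z.2.1) h, congrArg (fun z => z.2.2) h⟩

/-- Both sides have the same target, source and image under `F`, and full faithfulness
(`Hom.arr_ext`) makes them equal. -/
theorem Hom.inverse_comp (hl : LeftInverse K F.toPullback) (hr : RightInverse K F.toPullback)
    {q q' q'' : G.pullbackArr F.obj} (e : q.1.2.2 = q'.1.1) (ht : q''.1.1 = q.1.1)
    (ha : q''.1.2.1 = G.comp q.1.2.1 q'.1.2.1) (hs : q''.1.2.2 = q'.1.2.2) :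
    K q'' = H.comp (K q) (K q') := by
  have hK := Hom.inverse_spec hr
  have e' : H.src (K q) = H.tgt (K q') := by rw [(hK q).2.2, (hK q').1, e]
  refine Hom.arr_ext hl ?_ ?_ ?_
  · rw [tgt_comp e', (hK _).1, (hK _).1, ht]
  · rw [F.map_comp e', (hK _).2.1, (hK _).2.1, (hK _).2.1, ha]
  · rw [src_comp e', (hK _).2.2, (hK _).2.2, hs]

variable (s : LocalLifts F ι)

/-- The functor from `G`, with objects labelled by local lifts, to `H`. -/
noncomputable def LocalLifts.functor (hl : LeftInverse K F.toPullback)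
    (hr : RightInverse K F.toPullback)
    (hK : SmoothOnSubset ((𝓡 H.dimObj).prod ((𝓡 G.dimArr).prod (𝓡 H.dimObj))) (𝓡 H.dimArr)
      (G.pullbackArr F.obj) K) : LabelledFunctor G H ι where
  obj := s.lift
  arr a b g := K ⟨(s.lift b (G.tgt g), G.conj (s.arrow b (G.tgt g)) g (s.arrow a (G.src g)),
    s.lift a (G.src g)), by
      constructor
      · rw [tgt_conj (s.tgt_arrow _ _).symm (s.tgt_arrow _ _), s.src_arrow]
      · rw [src_conj (s.tgt_arrow _ _).symm (s.tgt_arrow _ _), s.src_arrow]⟩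
  dom := s.dom
  src_arr a b g := (Hom.inverse_spec hr _).2.2
  tgt_arr a b g := (Hom.inverse_spec hr _).1
  map_comp a b c g h e := by
    refine Hom.inverse_comp hl hr (congrArg (s.lift b) e) (congrArg (s.lift c) (tgt_comp e)) ?_
      (congrArg (s.lift a) (src_comp e))
    dsimp only
    rw [src_comp e, tgt_comp e, e, conj_comp_conj (s.tgt_arrow _ _).symm (s.tgt_arrow _ _)
      (e.trans (s.tgt_arrow _ _).symm) (s.tgt_arrow _ _)]
  isOpen_dom := s.isOpen_dom
  smooth_obj i := SmoothOnSubset.of_contMDiffOn (s.isOpen_dom i) (s.smooth_lift i)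
  smooth_arr a b := by
    have hsrc : SmoothOnSubset (𝓡 G.dimArr) (𝓡 G.dimObj)
      {g | G.src g ∈ s.dom a ∧ G.tgt g ∈ s.dom b}
      (fun g => G.src g) := SmoothOnSubset.of_contMDiff G.smooth_src
    have htgt : SmoothOnSubset (𝓡 G.dimArr) (𝓡 G.dimObj)
      {g | G.src g ∈ s.dom a ∧ G.tgt g ∈ s.dom b}
      (fun g => G.tgt g) := SmoothOnSubset.of_contMDiff G.smooth_tgt
    have ha := fun i => SmoothOnSubset.of_contMDiffOn (s.isOpen_dom i) (s.smooth_arrow i)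
    have hx := fun i => SmoothOnSubset.of_contMDiffOn (s.isOpen_dom i) (s.smooth_lift i)
    refine hK.comp (g := fun g : {g | G.src g ∈ s.dom a ∧ G.tgt g ∈ s.dom b} => ⟨_, _⟩) ?_
    refine SmoothOnSubset.prodMk ?_ (SmoothOnSubset.prodMk (smooth_conj ?_ ?_ ?_ ?_ ?_) ?_)
    · exact (hx b).comp (g := fun g : {g | G.src g ∈ s.dom a ∧ G.tgt g ∈ s.dom b} =>
        ⟨G.tgt g, g.2.2⟩) htgt
    · exact (ha b).comp (g := fun g : {g | G.src g ∈ s.dom a ∧ G.tgt g ∈ s.dom b} =>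
        ⟨G.tgt g, g.2.2⟩) htgt
    · exact SmoothOnSubset.of_contMDiff contMDiff_id
    · exact (ha a).comp (g := fun g : {g | G.src g ∈ s.dom a ∧ G.tgt g ∈ s.dom b} =>
        ⟨G.src g, g.2.1⟩) hsrc
    · exact fun _ => (s.tgt_arrow _ _).symm
    · exact fun _ => s.tgt_arrow _ _
    · exact (hx a).comp (g := fun g : {g | G.src g ∈ s.dom a ∧ G.tgt g ∈ s.dom b} =>
        ⟨G.src g, g.2.1⟩) hsrc

/-- Conjugation in `G` with the arrows of local lifts. -/
noncomputable def LocalLifts.conjFunctor : LabelledFunctor G G (Option ι) :=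
  optionConjFunctor s.arrow s.dom s.tgt_arrow s.isOpen_dom
    fun i => SmoothOnSubset.of_contMDiffOn (s.isOpen_dom i) (s.smooth_arrow i)

/-- The arrow `lift i (F x) → x` in `H` that corresponds to the arrow of a local lift of `F x`. -/
def LocalLifts.liftedArrow (K : G.pullbackArr F.obj → H.Arr) (i : ι) (x : H.Obj) : H.Arr :=
  K ⟨(x, s.arrow i (F.obj x), s.lift i (F.obj x)), (s.tgt_arrow _ _).symm, s.src_arrow _ _⟩

/-- Conjugation in `H` with the arrows that correspond to those of local lifts. -/
noncomputable def LocalLifts.liftedConjFunctor (hr : RightInverse K F.toPullback)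
    (hK : SmoothOnSubset ((𝓡 H.dimObj).prod ((𝓡 G.dimArr).prod (𝓡 H.dimObj))) (𝓡 H.dimArr)
      (G.pullbackArr F.obj) K) : LabelledFunctor H H (Option ι) :=
  optionConjFunctor (s.liftedArrow K) (fun i => F.obj ⁻¹' s.dom i)
    (fun _ _ => (Hom.inverse_spec hr _).1)
    (fun i => (s.isOpen_dom i).preimage F.smooth_obj.continuous) fun i => by
      have hf : SmoothOnSubset (𝓡 H.dimObj) (𝓡 G.dimObj) (F.obj ⁻¹' s.dom i) (fun x => F.obj x) :=
        SmoothOnSubset.of_contMDiff F.smooth_obj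
      refine hK.comp (g := fun x : F.obj ⁻¹' s.dom i => ⟨_, _⟩) ?_
      refine SmoothOnSubset.prodMk (SmoothOnSubset.of_contMDiff contMDiff_id)
        (SmoothOnSubset.prodMk ?_ ?_)
      · exact (SmoothOnSubset.of_contMDiffOn (s.isOpen_dom i) (s.smooth_arrow i)).comp
          (g := fun x : F.obj ⁻¹' s.dom i => ⟨F.obj x, x.2⟩) hf
      · exact (SmoothOnSubset.of_contMDiffOn (s.isOpen_dom i) (s.smooth_lift i)).comp
          (g := fun x : F.obj ⁻¹' s.dom i => ⟨F.obj x, x.2⟩) hf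

variable {n : ℕ} (hl : LeftInverse K F.toPullback) (hr : RightInverse K F.toPullback)
    (hK : SmoothOnSubset ((𝓡 H.dimObj).prod ((𝓡 G.dimArr).prod (𝓡 H.dimObj))) (𝓡 H.dimArr)
      (G.pullbackArr F.obj) K)

/-- `K` preserves the middle component, so applying `F` to a lifted arrow returns the conjugate it
was lifted from. -/
theorem LocalLifts.mapString_functor (p : G.nerve n) (a : Fin (n + 1) → ι)
    (b : Fin (n + 1) → Unit) :
    F.toLabelledFunctor.mapString ((s.functor hl hr hK).mapString p a) b =
      s.conjFunctor.mapString p (fun j => some (a j)) :=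
  nerve_ext (fun j => (s.src_arrow (a j) (p.1.1 j)).symm) fun j => by
    rw [LabelledFunctor.mapString_arr, LabelledFunctor.mapString_arr,
      LabelledFunctor.mapString_arr]
    exact (Hom.inverse_spec hr _).2.1

/-- The lifted arrows lie over the arrows of the local lifts, so conjugating in `H` and lifting the
conjugate from `G` give arrows with the same endpoints and the same image under `F`; faithfulness
identifies them. -/
theorem LocalLifts.functor_mapString (p : H.nerve n) (a : Fin (n + 1) → ι)
    (b : Fin (n + 1) → Unit) :
    (s.functor hl hr hK).mapString (F.toLabelledFunctor.mapString p b) a =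
      (s.liftedConjFunctor hr hK).mapString p (fun j => some (a j)) := by
  have hK' := Hom.inverse_spec hr
  have ht : ∀ i x, H.tgt (s.liftedArrow K i x) = x := fun _ _ => (hK' _).1
  have hs : ∀ i x, H.src (s.liftedArrow K i x) = s.lift i (F.obj x) := fun _ _ => (hK' _).2.2
  have ha : ∀ i x, F.arr (s.liftedArrow K i x) = s.arrow i (F.obj x) := fun _ _ => (hK' _).2.1
  refine nerve_ext (fun j => (hs (a j) (p.1.1 j)).symm) fun j => ?_
  rw [LabelledFunctor.mapString_arr, LabelledFunctor.mapString_arr, LabelledFunctor.mapString_arr]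
  change K _ = H.conj (s.liftedArrow K (a j.succ) (H.tgt (p.1.2 j))) (p.1.2 j)
    (s.liftedArrow K (a j.castSucc) (H.src (p.1.2 j)))
  refine Hom.arr_ext hl ?_ ?_ ?_
  · rw [(hK' _).1, tgt_conj (ht _ _).symm (ht _ _), hs]
    exact congrArg _ (F.tgt_arr _)
  · rw [(hK' _).2.1, F.map_conj (ht _ _).symm (ht _ _), ha, ha, ← F.tgt_arr, ← F.src_arr]
    rfl
  · rw [(hK' _).2.2, src_conj (ht _ _).symm (ht _ _), hs]
    exact congrArg _ (F.src_arr _)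

end WeakEquivalence

end LieGroupoid

namespace LieGroupoid

variable {G H : LieGroupoid.{u}}

/-! ### Morita invariance of differentiable cohomology -/

section Complexes

theorem cochainComplex_d (n : ℕ) :
    G.cochainComplex.d n (n + 1) = ModuleCat.ofHom (G.differential n) :=
  CochainComplex.of_d (fun n => ModuleCat.of ℝ (G.Cochain n))
    (fun n => ModuleCat.ofHom (G.differential n)) n

/-- The chain map given by linear maps that commute with the differentials. -/
noncomputable def cochainMap (f : ∀ n, H.Cochain n →ₗ[ℝ] G.Cochain n)
    (hf : ∀ n c, G.differential n (f n c) = f (n + 1) (H.differential n c)) :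
    H.cochainComplex ⟶ G.cochainComplex :=
  CochainComplex.ofHom (X := H.cochainComplex) (Y := G.cochainComplex)
    (fun n => ModuleCat.ofHom (f n)) fun n => by
      rw [cochainComplex_d, cochainComplex_d]
      exact ModuleCat.hom_ext (LinearMap.ext fun c => hf n c)

/-- A homotopy from a chain map to the identity, given by linear maps. -/
noncomputable def cochainHomotopyToId (φ : G.cochainComplex ⟶ G.cochainComplex)
    (k : ∀ n, G.Cochain (n + 1) →ₗ[ℝ] G.Cochain n)
    (h0 : ∀ c : G.Cochain 0, k 0 (G.differential 0 c) + c = (φ.f 0).hom c)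
    (hs : ∀ n (c : G.Cochain (n + 1)), k (n + 1) (G.differential (n + 1) c) +
      G.differential n (k n c) + c = (φ.f (n + 1)).hom c) :
    Homotopy φ (𝟙 G.cochainComplex) where
  hom i j := if h : j + 1 = i then by
      subst h
      exact ModuleCat.ofHom (k j)
    else 0
  zero i j h := dif_neg h
  comm i := by
    rw [Homotopy.dNext_cochainComplex]
    cases i with
    | zero =>
      rw [Homotopy.prevD_zero_cochainComplex, add_zero, dif_pos rfl, cochainComplex_d]
      exact ModuleCat.hom_ext (LinearMap.ext fun c => (h0 c).symm)
    | succ n =>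
      rw [Homotopy.prevD_succ_cochainComplex, dif_pos rfl, dif_pos rfl, cochainComplex_d,
        cochainComplex_d]
      exact ModuleCat.hom_ext (LinearMap.ext fun c => (hs n c).symm)

end Complexes

theorem Hom.IsWeakEquivalence.nonempty_homotopyEquiv {F : Hom H G} (hF : F.IsWeakEquivalence) :
    Nonempty (HomotopyEquiv H.cochainComplex G.cochainComplex) := by
  obtain ⟨hess, K, hl, hr, hK⟩ := hF
  obtain ⟨s, hs⟩ := hess.exists_localLifts
  -- Together with second countability this gives σ-compactness, required for the partition of
  -- unity.
  have : LocallyCompactSpace G.Obj :=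
    ChartedSpace.locallyCompactSpace (EuclideanSpace ℝ (Fin G.dimObj)) G.Obj
  obtain ⟨ρ, hρ⟩ := SmoothPartitionOfUnity.exists_isSubordinate (𝓡 G.dimObj) isClosed_univ s.dom
    s.isOpen_dom fun y _ => mem_iUnion.2 ⟨y, hs y⟩
  -- With weights pulled back along `F`, a string in `H` and its image in `G` have the same label
  -- weights, so `P ∘ Q` is an average over `ρ'`.
  let ρ' := ρ.comap F.smooth_obj
  have hρ' : ρ'.IsSubordinate fun i => F.obj ⁻¹' s.dom i := fun i =>
    (tsupport_comp_subset_preimage (ρ i) F.smooth_obj.continuous).trans (preimage_mono (hρ i))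
  let L := s.functor hl hr hK
  let LG := s.conjFunctor
  let LH := s.liftedConjFunctor hr hK
  let P : ∀ n, G.Cochain n →ₗ[ℝ] H.Cochain n :=
    averagePullback ρ' F.toLabelledFunctor (fun _ => ()) fun _ => subset_univ _
  let Q : ∀ n, H.Cochain n →ₗ[ℝ] G.Cochain n := averagePullback ρ L id hρ
  -- For a functor independent of labels the average is trivial: `P` is plain pullback along `F`.
  have hP : ∀ n (c : G.Cochain n) (p : H.nerve n),
      (P n c).1 p = c.1 (F.toLabelledFunctor.mapString p fun _ => ()) := fun n c p =>
    labelAverage_const (finite_support_labelWeight ρ' p) (finsum_labelWeight ρ' p)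
      (c.1 (F.toLabelledFunctor.mapString p fun _ => ()))
  have hGn : ρ.IsSubordinate fun _ => LG.dom none := fun _ => subset_univ _
  have hHn : ρ'.IsSubordinate fun _ => LH.dom none := fun _ => subset_univ _
  have hLG : ∀ n c, averagePullback ρ LG (fun _ => none) hGn n c = c :=
    averagePullback_optionConjFunctor_none ρ hGn
  have hLH : ∀ n c, averagePullback ρ' LH (fun _ => none) hHn n c = c :=
    averagePullback_optionConjFunctor_none ρ' hHn
  have hG : ρ.IsSubordinate fun i => LG.dom (some i) := hρ
  have hH : ρ'.IsSubordinate fun i => LH.dom (some i) := hρ'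
  have hQP : ∀ n c, Q n (P n c) = averagePullback ρ LG some hG n c := fun n c =>
    Subtype.ext <| funext fun p => congrArg (labelAverage (labelWeight ρ p)) <| funext fun a => by
      rw [hP]
      exact congrArg c.1 (s.mapString_functor hl hr hK p a _)
  have hPQ : ∀ n c, P n (Q n c) = averagePullback ρ' LH some hH n c := fun n c =>
    Subtype.ext <| funext fun p => by
      rw [hP]
      exact congrArg (labelAverage (labelWeight ρ' p)) <| funext fun a =>
        congrArg c.1 (s.functor_mapString hl hr hK p a _)
  -- The prisms run from the labelling by `none`, whose average is the identity, to the labelling by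
  -- `some`, whose average is the composite.
  have hGi : ρ.IsSubordinate fun i => LG.dom none ∩ LG.dom (some i) := fun i =>
    subset_inter (hGn i) (hG i)
  have hHi : ρ'.IsSubordinate fun i => LH.dom none ∩ LH.dom (some i) := fun i =>
    subset_inter (hHn i) (hH i)
  let φ := cochainMap P (differential_averagePullback ρ' _ _ _)
  let ψ := cochainMap Q (differential_averagePullback ρ _ _ _)
  refine ⟨⟨ψ, φ, ?_, ?_⟩⟩
  · refine cochainHomotopyToId _ (averagePrism ρ' LH (fun _ => none) some hHi) (fun c => ?_)
      fun n c => ?_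
    · refine Eq.trans ?_ (hPQ 0 c).symm
      rw [← averagePrism_homotopy_zero ρ' LH _ _ hHi hHn hH, hLH]
    · refine Eq.trans ?_ (hPQ (n + 1) c).symm
      rw [← averagePrism_homotopy_succ ρ' LH _ _ hHi hHn hH, hLH]
  · refine cochainHomotopyToId _ (averagePrism ρ LG (fun _ => none) some hGi) (fun c => ?_)
      fun n c => ?_
    · refine Eq.trans ?_ (hQP 0 c).symm
      rw [← averagePrism_homotopy_zero ρ LG _ _ hGi hGn hG, hLG]
    · refine Eq.trans ?_ (hQP (n + 1) c).symm
      rw [← averagePrism_homotopy_succ ρ LG _ _ hGi hGn hG, hLG]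

end LieGroupoid

theorem mainTheorem9 (G H : LieGroupoid.{u}) (h : LieGroupoid.MoritaEquivalent G H) :
    Nonempty (∀ n : ℕ, G.cohomology n ≃ₗ[ℝ] H.cohomology n) := by
  induction h with
  | rel A B h =>
    obtain ⟨F, hF⟩ := h
    obtain ⟨e⟩ := hF.nonempty_homotopyEquiv
    exact ⟨fun n => (e.toHomologyIso n).toLinearEquiv⟩
  | refl A => exact ⟨fun n => LinearEquiv.refl ℝ _⟩
  | symm A B _ ih => exact ih.map fun e n => (e n).symm
  | trans A B C _ _ ih ih' => exact ih.elim fun e => ih'.map fun e' n => (e n).trans (e' n)
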